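/- **Programs and stable models.** A vocabulary consists of predicate and function constants with arities (individual constants are nullary function constants, propositions are nullary predicate constants). A *disjunctive program* $\Pi$ is a finite set of rules $\gamma:\ \zeta_1\wedge\dots\wedge\zeta_m\to\zeta_{m+1}\vee\dots\vee\zeta_n$ with $0\le m\le n$, $n>0$, where the head atoms $\zeta_{m+1},\dots,\zeta_n$ are atoms not involving equality and the body literals $\zeta_1,\dots,\zeta_m$ are atoms (possibly equalities) or negations of atoms; an empty head is $\bot$. It is *normal* if every head contains at most one atom. A predicate is *intensional* if it occurs in the head of some rule; $\tau$ denotes the set of intensional predicates. $\mathrm{SM}(\Pi)$ is the second-order sentence $\varphi\wedge\forall\tau^*(\tau^*<\tau\to\neg\varphi^*)$, where $\tau^*$ consists of a predicate variable $P^*$ for each $P\in\tau$, $\varphi$ is the conjunction of the universal closures of the rules, $\tau^*<\tau$ is $\bigwedge_{P\in\tau}\forall\bar x(P^*(\bar x)\to P(\bar x))\wedge\neg\bigwedge_{P\in\tau}\forall\bar x(P(\bar x)\to P^*(\bar x))$, and $\varphi^*$ is obtained from $\varphi$ by replacing all positive (non-negated) occurrences of each $P\in\tau$ in heads and bodies by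 $P^*$. **The translation.** Let $\Pi$ be a disjunctive program. Take new predicates $\mathrm{enc},\underline{\mathrm{enc}},\mathrm{mrg}$ (ternary), $\mathrm{ok},\mathrm{in},\mathrm{subc},\mathrm{equ}$ (binary), $\mathrm{true},\mathrm{false}$ (unary) and the set $C_\Pi$ of new individual constants consisting of $c_\epsilon$ and of $c_P$ for each predicate constant $P$ occurring in $\Pi$. For an atom $\vartheta=P(r_1,\dots,r_m)$ and terms $s,t$, write $\mathrm{enc}(s,\lceil\vartheta\rceil,t)$ for $u_0=c_P\wedge\mathrm{enc}(u_0,r_1,u_1)\wedge\dots\wedge\mathrm{enc}(u_{m-1},r_m,u_m)\wedge\mathrm{enc}(s,u_m,t)$, with new variables $u_j$ for each such occurrence. Let $\Pi^\diamond=\Pi_1\cup\dots\cup\Pi_5$, where: 1. $\Pi_1$ consists of $\mathrm{enc}(x,y,c)\to\bot$ for each $c\in C_\Pi$; $c=c'\to\bot$ for all distinct constants $c,c'\in C_\Pi$; and $\neg\underline{\mathrm{enc}}(x,y,z)\to\mathrm{enc}(x,y,z)$; $\neg\mathrm{enc}(x,y,z)\to\underline{\mathrm{enc}}(x,y,z)$;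 $\mathrm{enc}(x,y,z)\wedge\mathrm{enc}(u,v,z)\wedge\neg x=u\to\bot$; $\mathrm{enc}(x,y,z)\wedge\mathrm{enc}(u,v,z)\wedge\neg y=v\to\bot$; $\mathrm{enc}(x,y,z)\to\mathrm{ok}(x,y)$; $\neg\mathrm{ok}(x,y)\to\mathrm{ok}(x,y)$; $\mathrm{enc}(x,y,z)\wedge\mathrm{enc}(x,y,u)\wedge\neg z=u\to\bot$. 2. $\Pi_2$ consists of $y=c_\epsilon\to\mathrm{mrg}(x,y,x)$; $\mathrm{mrg}(x,u,v)\wedge\mathrm{enc}(u,w,y)\wedge\mathrm{enc}(v,w,z)\to\mathrm{mrg}(x,y,z)$; $\mathrm{enc}(x,u,y)\to\mathrm{in}(u,y)$; $\mathrm{enc}(x,z,y)\wedge\mathrm{in}(u,x)\to\mathrm{in}(u,y)$; $x=c_\epsilon\to\mathrm{subc}(x,y)$; $\mathrm{subc}(u,y)\wedge\mathrm{enc}(u,v,x)\wedge\mathrm{in}(v,y)\to\mathrm{subc}(x,y)$; $\mathrm{subc}(x,y)\wedge\mathrm{subc}(y,x)\to\mathrm{equ}(x,y)$. 3. $\Pi_3$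 consists of $\mathrm{true}(x)\wedge\mathrm{equ}(x,y)\to\mathrm{true}(y)$ and, for each rule $\gamma\in\Pi$ with head $\zeta_1\vee\dots\vee\zeta_n$ ($n\ge0$), the rule $$\bigwedge_{i=1}^k\mathrm{true}(x_i)\wedge\bigwedge_{i=1}^k\mathrm{enc}(y_i,\lceil\vartheta_i\rceil,x_i)\wedge M_\gamma\wedge\gamma_B^-\to\mathrm{true}(z),$$ where $\vartheta_1,\dots,\vartheta_k$ list the intensional (non-equality) atoms that occur positively in the body of $\gamma$, $\gamma_B^-$ is the conjunction of the remaining body literals, and $M_\gamma$ is $\bigwedge_{i=1}^n\mathrm{enc}(v_{i-1},\lceil\zeta_i\rceil,v_i)\wedge\bigwedge_{i=1}^k\mathrm{mrg}(w_{i-1},y_i,w_i)\wedge v_0=c_\epsilon\wedge w_0=v_n\wedge z=w_k$; all variables $x_i,y_i,z,v_i,w_i$ are new. 4. $\Pi_4$ consists of $x=c_\epsilon\to\mathrm{false}(x)$ and, for each $P\in\tau$, the rule $\mathrm{false}(x)\wedge\mathrm{enc}(x,\lceil\vartheta\rceil,y)\wedge\neg\vartheta\to\mathrm{false}(y)$,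 where $\vartheta=P(z_1,\dots,z_{k_P})$ with $k_P$ the arity of $P$ and distinct variables $z_i$ different from $x,y$. 5. $\Pi_5$ consists of $\mathrm{true}(c_\epsilon)\to\bot$ and, for each $P\in\tau$ with $\vartheta$ as in 4, the rule $\mathrm{true}(x)\wedge\mathrm{enc}(y,\lceil\vartheta\rceil,x)\wedge\mathrm{false}(y)\to\vartheta$. **Theorem.** Let $\Pi$ be a disjunctive program. Then $\Pi^\diamond$ is a (finite) normal program, and over infinite structures $\mathrm{SM}(\Pi)$ is equivalent to $\exists\pi\,\mathrm{SM}(\Pi^\diamond)$, where $\pi$ is the set of constants occurring in $\Pi^\diamond$ but not in $\Pi$ (the new predicates and the individual constants in $C_\Pi$). That is, an infinite structure $\mathbb A$ interpreting the constants of $\Pi$ satisfies $\mathrm{SM}(\Pi)$ if and only if some expansion of $\mathbb A$ by interpretations of the constants in $\pi$ satisfies $\mathrm{SM}(\Pi^\diamond)$. -/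

import Mathlib

universe u v w x

namespace DLP

/-! ## Syntax of disjunctive programs -/

/-- A predicate constant of the vocabulary `L`, together with its arity. -/
abbrev Pred (L : FirstOrder.Language.{u, v}) : Type v := Σ n : ℕ, L.Relations n

/-- An atom `P(t₁, …, tₘ)` over `L` (not an equality), with individual variables from `V`. -/
structure PAtom (L : FirstOrder.Language.{u, v}) (V : Type w) where
  pred : Pred L
  args : Fin pred.1 → L.Term V

/-- A literal: an atom or the negation of an atom, where the atom may be an equality. -/
inductive Literal (L : FirstOrder.Language.{u, v}) (V : Type w) where
  /-- `P(t₁, …, tₘ)` -/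
  | pos (a : PAtom L V)
  /-- `¬ P(t₁, …, tₘ)` -/
  | neg (a : PAtom L V)
  /-- `s = t` -/
  | eq (s t : L.Term V)
  /-- `¬ s = t` -/
  | ne (s t : L.Term V)

/-- A rule `ζ₁ ∧ ⋯ ∧ ζₘ → ζₘ₊₁ ∨ ⋯ ∨ ζₙ` with `n > 0`. The body consists of literals, the head
consists of atoms not involving equality; an empty head is `⊥`. -/
structure Rule (L : FirstOrder.Language.{u, v}) (V : Type w) where
  body : List (Literal L V)
  head : List (PAtom L V)
  nonempty : 0 < body.length + head.length

/-- A (possibly infinite) disjunctive program; finiteness is expressed by `Set.Finite`. -/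
abbrev Program (L : FirstOrder.Language.{u, v}) (V : Type w) : Type (max u v w) := Set (Rule L V)

/-- The predicates occurring in a literal. -/
def Literal.preds {L : FirstOrder.Language.{u, v}} {V : Type w} : Literal L V → Set (Pred L)
  | .pos a => {a.pred}
  | .neg a => {a.pred}
  | .eq _ _ => ∅
  | .ne _ _ => ∅

/-- The predicate constants occurring in a program. -/
def Program.preds {L : FirstOrder.Language.{u, v}} {V : Type w} (p : Program L V) : Set (Pred L) :=
  {P | ∃ γ ∈ p, (∃ l ∈ γ.body, P ∈ l.preds) ∨ ∃ a ∈ γ.head, a.pred = P}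

/-- The intensional predicates: those that occur in the head of some rule. -/
def Program.intensional {L : FirstOrder.Language.{u, v}} {V : Type w} (p : Program L V) : Set (Pred L) :=
  {P | ∃ γ ∈ p, ∃ a ∈ γ.head, a.pred = P}

/-- A program is normal if the head of each rule contains at most one atom. -/
def Program.IsNormal {L : FirstOrder.Language.{u, v}} {V : Type w} (p : Program L V) : Prop :=
  ∀ γ ∈ p, γ.head.length ≤ 1

/-! ## The second-order sentence `SM`

The satisfaction of `φ ∧ ∀ τ* (τ* < τ → ¬ φ*)` in a structure is spelled out directly. -/

/-- A choice of relations on `M` for the predicates of `L`. -/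
abbrev Interp (L : FirstOrder.Language.{u, v}) (M : Type x) : Type (max v x) :=
  ∀ P : Pred L, (Fin P.1 → M) → Prop

/-- The relations given by the structure itself. -/
def structInterp (L : FirstOrder.Language.{u, v}) (M : Type x) [L.Structure M] : Interp L M :=
  fun P a => FirstOrder.Language.Structure.RelMap P.2 a

/-- The atom `a` under the assignment `α`, predicates being read in `I`. -/
def PAtom.Holds {L : FirstOrder.Language.{u, v}} {V : Type w} {M : Type x} [L.Structure M]
    (a : PAtom L V) (I : Interp L M) (α : V → M) : Prop :=
  I a.pred (fun i => (a.args i).realize α)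

/-- A literal under `α`: the positive occurrences of predicates are read in `I`, the negated ones
in the structure. -/
def Literal.Holds {L : FirstOrder.Language.{u, v}} {V : Type w} {M : Type x} [L.Structure M]
    (l : Literal L V) (I : Interp L M) (α : V → M) : Prop :=
  match l with
  | .pos a => a.Holds I α
  | .neg a => ¬ a.Holds (structInterp L M) α
  | .eq s t => s.realize α = t.realize α
  | .ne s t => ¬ s.realize α = t.realize α

/-- The universal closure of the rule, positive occurrences of predicates being read in `I`. -/
def Rule.Holds {L : FirstOrder.Language.{u, v}} {V : Type w} {M : Type x} [L.Structure M]
    (γ : Rule L V) (I : Interp L M) : Prop :=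
  ∀ α : V → M, (∀ l ∈ γ.body, l.Holds I α) → ∃ a ∈ γ.head, a.Holds I α

open Classical in
/-- Replace the intensional predicates `P` by the values `I P` of the predicate variables `P*`, and
keep the other predicates as they are in the structure. -/
noncomputable def Program.star {L : FirstOrder.Language.{u, v}} {V : Type w} {M : Type x} [L.Structure M]
    (p : Program L V) (I : Interp L M) : Interp L M :=
  fun P => if P ∈ p.intensional then I P else structInterp L M P

/-- `τ* < τ`, for the set `τ` of intensional predicates. -/
def Program.StarLT {L : FirstOrder.Language.{u, v}} {V : Type w} {M : Type x} [L.Structure M]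
    (p : Program L V) (I : Interp L M) : Prop :=
  (∀ P ∈ p.intensional, ∀ a, I P a → structInterp L M P a) ∧
    ¬ ∀ P ∈ p.intensional, ∀ a, structInterp L M P a → I P a

/-- The structure `M` satisfies `SM(p)`, i.e. it is a stable model of `p`. -/
def Program.SM {L : FirstOrder.Language.{u, v}} {V : Type w}
    (p : Program L V) (M : Type x) [L.Structure M] : Prop :=
  (∀ γ ∈ p, γ.Holds (structInterp L M)) ∧
    ∀ I : Interp L M, p.StarLT I → ¬ ∀ γ ∈ p, γ.Holds (p.star I)

/-! ## The new constants -/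

/-- The new predicates. -/
inductive NewRel : ℕ → Type v
  | enc : NewRel 3
  /-- the complement of `enc` -/
  | nenc : NewRel 3
  | ok : NewRel 2
  | mrg : NewRel 3
  | mem : NewRel 2
  | subc : NewRel 2
  | equ : NewRel 2
  | tru : NewRel 1
  | fls : NewRel 1

/-- The new individual constants: the set `C` of encoding flags, consisting of `c_ε` and of `c_P`
for every predicate `P` occurring in the program. -/
inductive NewFun {L : FirstOrder.Language.{u, v}} {V : Type w} (p : Program L V) : ℕ → Type v
  | eps : NewFun p 0
  | flag (P : Pred L) (h : P ∈ p.preds) : NewFun p 0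

/-- The vocabulary of the new constants. -/
def newLang {L : FirstOrder.Language.{u, v}} {V : Type w} (p : Program L V) : FirstOrder.Language.{v, v} :=
  ⟨NewFun p, NewRel⟩

/-- The vocabulary of the translated program: `L` together with the new constants. -/
abbrev bigLang {L : FirstOrder.Language.{u, v}} {V : Type w} (p : Program L V) : FirstOrder.Language.{max u v, v} :=
  L.sum (newLang p)

/-- Names of the new individual variables. -/
inductive Letter
  | x | y | z | u | v | w
  /-- auxiliary variables for the codes of head atoms -/
  | s
  /-- the argument variables of the atoms `P(z₁, …, z_k)` -/
  | a

/-- Individual variables of the translated program: the old ones, and the new ones, which carry a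
name and two indices. -/
inductive DVar (V : Type w) : Type w
  | old (i : V)
  | new (l : Letter) (i j : ℕ)

section Translation

variable {L : FirstOrder.Language.{u, v}} {V : Type w} (p : Program L V)

/-- Terms of the translated program. -/
abbrev DTerm : Type (max u v w) := (bigLang p).Term (DVar V)

/-- Literals of the translated program. -/
abbrev DLit : Type (max u v w) := Literal (bigLang p) (DVar V)

/-- The new variable with name `l` and index `i`. -/
def nv (l : Letter) (i : ℕ := 0) : DTerm p := FirstOrder.Language.Term.var (DVar.new l i 0)

/-- A new individual constant as a term. -/
def cst (c : NewFun p 0) : DTerm p :=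
  FirstOrder.Language.Term.func (L := bigLang p) (l := 0) (Sum.inr c) Fin.elim0

/-- `c_ε` -/
def epsT : DTerm p := cst p NewFun.eps

open Classical in
/-- `c_P`; only used for predicates that occur in `p`. -/
noncomputable def flagT (P : Pred L) : DTerm p :=
  if h : P ∈ p.preds then cst p (NewFun.flag P h) else epsT p

/-- An atom built from a new predicate. -/
def newAtom {n : ℕ} (R : NewRel.{v} n) (ts : Fin n → DTerm p) : PAtom (bigLang p) (DVar V) :=
  ⟨⟨n, Sum.inr R⟩, ts⟩

def encA (s t r : DTerm p) : PAtom (bigLang p) (DVar V) := newAtom p NewRel.enc ![s, t, r]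
def nencA (s t r : DTerm p) : PAtom (bigLang p) (DVar V) := newAtom p NewRel.nenc ![s, t, r]
def okA (s t : DTerm p) : PAtom (bigLang p) (DVar V) := newAtom p NewRel.ok ![s, t]
def mrgA (s t r : DTerm p) : PAtom (bigLang p) (DVar V) := newAtom p NewRel.mrg ![s, t, r]
def memA (s t : DTerm p) : PAtom (bigLang p) (DVar V) := newAtom p NewRel.mem ![s, t]
def subcA (s t : DTerm p) : PAtom (bigLang p) (DVar V) := newAtom p NewRel.subc ![s, t]
def equA (s t : DTerm p) : PAtom (bigLang p) (DVar V) := newAtom p NewRel.equ ![s, t]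
def truA (t : DTerm p) : PAtom (bigLang p) (DVar V) := newAtom p NewRel.tru ![t]
def flsA (t : DTerm p) : PAtom (bigLang p) (DVar V) := newAtom p NewRel.fls ![t]

/-- An old term as a term of the translated program. -/
def liftT (t : L.Term V) : DTerm p :=
  (FirstOrder.Language.LHom.sumInl : FirstOrder.Language.LHom L (bigLang p)).onTerm (t.relabel DVar.old)

/-- An old literal as a literal of the translated program. -/
def liftLit : Literal L V → DLit p
  | .pos a => .pos ⟨⟨a.pred.1, Sum.inl a.pred.2⟩, fun i => liftT p (a.args i)⟩
  | .neg a => .neg ⟨⟨a.pred.1, Sum.inl a.pred.2⟩, fun i => liftT p (a.args i)⟩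
  | .eq s t => .eq (liftT p s) (liftT p t)
  | .ne s t => .ne (liftT p s) (liftT p t)

/-- The rule `body → h`. -/
def ruleTo (body : List (DLit p)) (h : PAtom (bigLang p) (DVar V)) :
    Rule (bigLang p) (DVar V) :=
  ⟨body, [h], by simp⟩

/-- The rule `b ∧ body → ⊥`. -/
def ruleBot (b : DLit p) (body : List (DLit p)) : Rule (bigLang p) (DVar V) :=
  ⟨b :: body, [], by simp⟩

/-- `enc(t₁, ⌈P(r₁, …, rₘ)⌉, t₂)`, i.e. the conjunction
`u₀ = c_P ∧ enc(u₀, r₁, u₁) ∧ ⋯ ∧ enc(uₘ₋₁, rₘ, uₘ) ∧ enc(t₁, uₘ, t₂)`,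
with the variables `uⱼ` given by the letter `l` and the first index `i`. -/
noncomputable def encAtom (l : Letter) (i : ℕ) (t₁ : DTerm p) (P : Pred L)
    (r : Fin P.1 → DTerm p) (t₂ : DTerm p) : List (DLit p) :=
  let uv : ℕ → DTerm p := fun j => FirstOrder.Language.Term.var (DVar.new l i j)
  [.eq (uv 0) (flagT p P)] ++
    (List.finRange P.1).map (fun j => .pos (encA p (uv j) (r j) (uv (j + 1)))) ++
    [.pos (encA p t₁ (uv P.1) t₂)]

/-- `enc` is the graph of an injective total function on pairs whose range contains no flag, and the flags
are pairwise distinct. -/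
def prog₁ : Program (bigLang p) (DVar V) :=
  let x := nv p .x; let y := nv p .y; let z := nv p .z; let u := nv p .u; let v := nv p .v
  {γ | ∃ c : NewFun p 0, γ = ruleBot p (.pos (encA p x y (cst p c))) []} ∪
  {γ | ∃ c d : NewFun p 0, c ≠ d ∧ γ = ruleBot p (.eq (cst p c) (cst p d)) []} ∪
  {ruleTo p [.neg (nencA p x y z)] (encA p x y z),
   ruleTo p [.neg (encA p x y z)] (nencA p x y z),
   ruleBot p (.pos (encA p x y z)) [.pos (encA p u v z), .ne x u],
   ruleBot p (.pos (encA p x y z)) [.pos (encA p u v z), .ne y v],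
   ruleTo p [.pos (encA p x y z)] (okA p x y),
   ruleTo p [.neg (okA p x y)] (okA p x y),
   ruleBot p (.pos (encA p x y z)) [.pos (encA p x y u), .ne z u]}

/-- Merging of codes of clauses, and the encoding predicates `in`, `subc`, `equ`. -/
def prog₂ : Program (bigLang p) (DVar V) :=
  let x := nv p .x; let y := nv p .y; let z := nv p .z; let u := nv p .u; let v := nv p .v
  let w := nv p .w
  {ruleTo p [.eq y (epsT p)] (mrgA p x y x),
   ruleTo p [.pos (mrgA p x u v), .pos (encA p u w y), .pos (encA p v w z)] (mrgA p x y z),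
   ruleTo p [.pos (encA p x u y)] (memA p u y),
   ruleTo p [.pos (encA p x z y), .pos (memA p u x)] (memA p u y),
   ruleTo p [.eq x (epsT p)] (subcA p x y),
   ruleTo p [.pos (subcA p u y), .pos (encA p u v x), .pos (memA p v y)] (subcA p x y),
   ruleTo p [.pos (subcA p x y), .pos (subcA p y x)] (equA p x y)}

open Classical in
/-- `ϑ₁, …, ϑ_k`: the intensional atoms occurring positively in the body of `γ`. -/
noncomputable def posInt (γ : Rule L V) : List (PAtom L V) :=
  γ.body.filterMap fun
    | .pos a => if a.pred ∈ p.intensional then some a else none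
    | _ => none

open Classical in
/-- The remaining literals of the body of `γ`. -/
noncomputable def restBody (γ : Rule L V) : List (Literal L V) :=
  γ.body.filter fun
    | .pos a => decide (a.pred ∉ p.intensional)
    | _ => true

/-- The conjunction `mrg(⌈γ_H⌉, y₁, …, y_k, z)`. -/
noncomputable def mrgHead (γ : Rule L V) (k : ℕ) : List (DLit p) :=
  γ.head.zipIdx.flatMap (fun ζi =>
    encAtom p .s ζi.2 (nv p .v ζi.2) ζi.1.pred (fun j => liftT p (ζi.1.args j))
      (nv p .v (ζi.2 + 1))) ++
  (List.range k).map (fun i => .pos (mrgA p (nv p .w i) (nv p .y (i + 1)) (nv p .w (i + 1)))) ++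
  [.eq (nv p .v 0) (epsT p), .eq (nv p .w 0) (nv p .v γ.head.length), .eq (nv p .z) (nv p .w k)]

/-- The rule simulating the application of `γ` in the progression. -/
noncomputable def simRule (γ : Rule L V) : Rule (bigLang p) (DVar V) :=
  let k := (posInt p γ).length
  ruleTo p
    ((List.range k).map (fun i => .pos (truA p (nv p .x (i + 1)))) ++
      (posInt p γ).zipIdx.flatMap (fun θi =>
        encAtom p .u (θi.2 + 1) (nv p .y (θi.2 + 1)) θi.1.pred
          (fun j => liftT p (θi.1.args j)) (nv p .x (θi.2 + 1))) ++
      mrgHead p γ k ++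
      (restBody p γ).map (liftLit p))
    (truA p (nv p .z))

/-- Simulation of the progression operator of `p`. -/
noncomputable def prog₃ : Program (bigLang p) (DVar V) :=
  let x := nv p .x; let y := nv p .y
  {ruleTo p [.pos (truA p x), .pos (equA p x y)] (truA p y)} ∪ {δ | ∃ γ ∈ p, δ = simRule p γ}

/-- The variables `z₁, …, z_k` for a predicate of arity `k`. -/
def argVars (P : Pred L) : Fin P.1 → DTerm p := fun i => nv p .a i

/-- The atom `P(z₁, …, z_k)`. -/
def genAtom (P : Pred L) : PAtom (bigLang p) (DVar V) := ⟨⟨P.1, Sum.inl P.2⟩, argVars p P⟩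

/-- `fls` holds of the codes of clauses that are false in the structure. -/
noncomputable def prog₄ : Program (bigLang p) (DVar V) :=
  let x := nv p .x; let y := nv p .y
  {ruleTo p [.eq x (epsT p)] (flsA p x)} ∪
  {δ | ∃ P ∈ p.intensional, δ = ruleTo p
    ([.pos (flsA p x)] ++ encAtom p .u 0 x P (argVars p P) y ++ [.neg (genAtom p P)]) (flsA p y)}

/-- Shifting of the clauses obtained by the progression. -/
noncomputable def prog₅ : Program (bigLang p) (DVar V) :=
  let x := nv p .x; let y := nv p .y
  {ruleBot p (.pos (truA p (epsT p))) []} ∪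
  {δ | ∃ P ∈ p.intensional, δ = ruleTo p
    ([.pos (truA p x)] ++ encAtom p .u 0 y P (argVars p P) x ++ [.pos (flsA p y)]) (genAtom p P)}

/-- The translation of `p` to a normal program. -/
noncomputable def diamond : Program (bigLang p) (DVar V) :=
  prog₁ p ∪ prog₂ p ∪ prog₃ p ∪ prog₄ p ∪ prog₅ p

end Translation

end DLP

/-! Fix a structure and let negated literals be read in it. Hyperresolution on the ground rules
derives finite clauses of intensional ground atoms: a rule whose remaining body literals hold turns
derived clauses `Cᵢ ∨ ϑᵢ`, one for each positive intensional body atom, into `head ∨ C₁ ∨ ⋯ ∨ C_k`.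
By `Program.SM_iff_supported` the structure is stable iff every derived clause is true and every
true intensional atom `a` is supported, that is, some derived clause consists of `a` and of false
atoms. Given a true unsupported `a`, the true atoms other than `a` still meet every derived clause;
Zorn's lemma yields a minimal such set, which is a strictly smaller model of the reduct.

The normal program computes with codes of these clauses. If `enc` is the graph of an injective
pairing `f` whose range avoids the distinct flags, then iterated pairing from a flag codes finite
sequences, and a code determines its sequence. Under the resulting intended reading (`newSpec`),
`true` holds of the codes of derived clauses, `false` of the codes of false clauses, and the rules
of the fifth part derive exactly the supported atoms. This reading satisfies all rules
(`IsSpec.diamond_holds`) and lies below every interpretation that satisfies them (`new_of_holds`,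
`old_of_holds`). So, once `enc` is such a pairing, stability of the translated program means that
the structure has the intended reading: the intensional atoms are the supported ones and, by the
constraint on `c_ε`, the empty clause is not derived. That is stability of the original program.

It remains to obtain the pairing. In one direction it exists because the structure is infinite and
there are finitely many flags. In the other, stability forces it: `swapEnc` is a smaller
interpretation satisfying the rules, so it cannot be strictly smaller, which makes `enc` the
complement of its companion and total on pairs (`exists_isEncoding`); the constraints give the rest.
-/

namespace DLP

/-! ### Hyperresolution on ground clauses and the characterization of stable models by support -/

section Ground

variable {L : FirstOrder.Language.{u, v}} {V : Type w} {M : Type x} [L.Structure M]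

/-- Ground atoms over the universe `M`. -/
abbrev GAtom (L : FirstOrder.Language.{u, v}) (M : Type x) : Type (max v x) :=
  Σ P : Pred L, (Fin P.1 → M)

/-- The ground instance of an atom under an assignment. -/
def PAtom.ground (a : PAtom L V) (α : V → M) : GAtom L M :=
  ⟨a.pred, fun i => (a.args i).realize α⟩

/-- Truth of a ground atom. -/
def Interp.Sat (I : Interp L M) (a : GAtom L M) : Prop := I a.1 a.2

/-- The clauses obtained from the reduct of `p` by hyperresolution. -/
inductive Derives (p : Program L V) (M : Type x) [L.Structure M] : List (GAtom L M) → Prop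
  | rule (γ : Rule L V) (hγ : γ ∈ p) (α : V → M) (C : ℕ → List (GAtom L M))
      (hC : ∀ (i : ℕ) (h : i < (posInt p γ).length),
        Derives p M (C i ++ [((posInt p γ)[i]).ground α]))
      (hr : ∀ l ∈ restBody p γ, l.Holds (structInterp L M) α) :
      Derives p M (γ.head.map (fun a => a.ground α) ++
        (List.range (posInt p γ).length).flatMap C)
  | congr (C C' : List (GAtom L M)) (h : Derives p M C) (hC : ∀ a, a ∈ C ↔ a ∈ C') :
      Derives p M C'

theorem mem_posInt {p : Program L V} {γ : Rule L V} {a : PAtom L V} :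
    a ∈ posInt p γ ↔ .pos a ∈ γ.body ∧ a.pred ∈ p.intensional := by
  classical
  unfold posInt
  rw [List.mem_filterMap]
  constructor
  · rintro ⟨l, hl, h⟩
    cases l <;> simp at h
    obtain ⟨h1, rfl⟩ := h
    exact ⟨hl, h1⟩
  · rintro ⟨h1, h2⟩
    exact ⟨_, h1, by simp [h2]⟩

theorem mem_restBody {p : Program L V} {γ : Rule L V} {l : Literal L V} :
    l ∈ restBody p γ ↔ l ∈ γ.body ∧ ∀ a, l = .pos a → a.pred ∉ p.intensional := by
  classical
  unfold restBody
  rw [List.mem_filter]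
  cases l <;> simp

/-- `K` reads the predicates outside `p.intensional` as the structure does. -/
def Program.Fixes (p : Program L V) (K : Interp L M) : Prop :=
  ∀ P, P ∉ p.intensional → K P = structInterp L M P

theorem Program.fixes_star (p : Program L V) (I : Interp L M) : p.Fixes (p.star I) :=
  fun P hP => by simp [Program.star, hP]

theorem Program.fixes_structInterp (p : Program L V) : p.Fixes (structInterp L M) :=
  fun _ _ => rfl

theorem Program.star_of_mem {p : Program L V} {P : Pred L} (h : P ∈ p.intensional)
    (I : Interp L M) : p.star I P = I P := by
  simp [Program.star, h]

theorem Program.Fixes.star_eq {p : Program L V} {K : Interp L M} (h : p.Fixes K) :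
    p.star K = K := by
  funext P
  by_cases hP : P ∈ p.intensional
  · exact p.star_of_mem hP K
  · rw [h P hP, p.fixes_star K P hP]

theorem body_holds_iff {p : Program L V} {K : Interp L M} (hK : p.Fixes K) (γ : Rule L V)
    (α : V → M) :
    (∀ l ∈ γ.body, l.Holds K α) ↔ (∀ a ∈ posInt p γ, K.Sat (a.ground α)) ∧
      ∀ l ∈ restBody p γ, l.Holds (structInterp L M) α := by
  constructor
  · intro h
    refine ⟨fun a ha => h _ (mem_posInt.1 ha).1, fun l hl => ?_⟩
    obtain ⟨h1, h2⟩ := mem_restBody.1 hl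
    have h3 := h l h1
    cases l with
    | pos a =>
      have h4 := hK _ (h2 a rfl)
      simpa only [Literal.Holds, PAtom.Holds, h4] using h3
    | neg a => exact h3
    | eq s t => exact h3
    | ne s t => exact h3
  · rintro ⟨h1, h2⟩ l hl
    by_cases hr : l ∈ restBody p γ
    · have h3 := h2 l hr
      cases l with
      | pos a =>
        have h4 := hK _ ((mem_restBody.1 hr).2 a rfl)
        simpa only [Literal.Holds, PAtom.Holds, h4] using h3
      | neg a => exact h3
      | eq s t => exact h3
      | ne s t => exact h3
    · rw [mem_restBody] at hr
      push Not at hr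
      obtain ⟨a, rfl, ha⟩ := hr hl
      exact h1 a (mem_posInt.2 ⟨hl, ha⟩)

theorem Derives.pred_mem {p : Program L V} {C : List (GAtom L M)} (h : Derives p M C) :
    ∀ a ∈ C, a.1 ∈ p.intensional := by
  induction h with
  | rule γ hγ α C hC hr ih =>
    intro a ha
    simp only [List.mem_append, List.mem_map, List.mem_flatMap, List.mem_range] at ha
    rcases ha with ⟨b, hb, rfl⟩ | ⟨i, hi, ha⟩
    · exact ⟨γ, hγ, b, hb, rfl⟩
    · exact ih i hi a (by simp [ha])
  | congr C C' h hC ih => exact fun a ha => ih a ((hC a).2 ha)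

/-- Every model of the reduct satisfies the derived clauses. -/
theorem Derives.sound {p : Program L V} {K : Interp L M} (hK : p.Fixes K)
    (hp : ∀ γ ∈ p, γ.Holds K) {C : List (GAtom L M)} (h : Derives p M C) :
    ∃ a ∈ C, K.Sat a := by
  induction h with
  | rule γ hγ α C hC hr ih =>
    -- Either a side clause `C i` is already satisfied, or each premise must be satisfied by its
    -- resolved atom, so that the rule fires.
    by_cases hi : ∃ i, i < (posInt p γ).length ∧ ∃ a ∈ C i, K.Sat a
    · obtain ⟨i, hi, a, ha, h⟩ := hi
      refine ⟨a, ?_, h⟩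
      simp only [List.mem_append, List.mem_flatMap, List.mem_range]
      exact Or.inr ⟨i, hi, ha⟩
    · push Not at hi
      have hb : ∀ a ∈ posInt p γ, K.Sat (a.ground α) := by
        intro a ha
        obtain ⟨i, hi', rfl⟩ := List.getElem_of_mem ha
        obtain ⟨b, hb, hs⟩ := ih i hi'
        rw [List.mem_append, List.mem_singleton] at hb
        rcases hb with hb | rfl
        · exact absurd hs (hi i hi' b hb)
        · exact hs
      obtain ⟨a, ha, hs⟩ := hp γ hγ α ((body_holds_iff hK γ α).2 ⟨hb, hr⟩)
      exact ⟨a.ground α, List.mem_append_left _ (List.mem_map_of_mem ha), hs⟩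
  | congr C C' h hC ih =>
    obtain ⟨a, ha, hs⟩ := ih
    exact ⟨a, (hC a).1 ha, hs⟩

/-- The atom `a` is supported: some derived clause has `a` as its only atom that may be true. -/
def Supported (p : Program L V) (K : Interp L M) (a : GAtom L M) : Prop :=
  ∃ C, Derives p M (C ++ [a]) ∧ ∀ b ∈ C, ¬ K.Sat b

/-- Resolve the rule against supporting clauses of its true positive body atoms. The result is a
derived clause, hence has a true atom; the side atoms are false, so the true atom lies in the head.
-/
theorem holds_of_supported {p : Program L V} {K : Interp L M} (hK : p.Fixes K)
    (hD : ∀ C, Derives p M C → ∃ a ∈ C, K.Sat a)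
    (hS : ∀ a : GAtom L M, a.1 ∈ p.intensional → K.Sat a → Supported p K a) :
    ∀ γ ∈ p, γ.Holds K := by
  intro γ hγ α hb
  obtain ⟨h1, h2⟩ := (body_holds_iff hK γ α).1 hb
  have h3 : ∀ i : ℕ, ∃ C : List (GAtom L M), ∀ h : i < (posInt p γ).length,
      Derives p M (C ++ [((posInt p γ)[i]).ground α]) ∧ ∀ b ∈ C, ¬ K.Sat b := by
    intro i
    by_cases h : i < (posInt p γ).length
    · obtain ⟨C, hC⟩ := hS (((posInt p γ)[i]).ground α)
        (mem_posInt.1 (List.getElem_mem h)).2 (h1 _ (List.getElem_mem h))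
      exact ⟨C, fun _ => hC⟩
    · exact ⟨[], fun h' => absurd h' h⟩
  choose C hC using h3
  obtain ⟨a, ha, hs⟩ := hD _ (Derives.rule γ hγ α C (fun i h => (hC i h).1) h2)
  simp only [List.mem_append, List.mem_map, List.mem_flatMap, List.mem_range] at ha
  rcases ha with ⟨b, hb, rfl⟩ | ⟨i, hi, ha⟩
  · exact ⟨b, hb, hs⟩
  · exact absurd hs ((hC i hi).2 a ha)

/-- Finitely many members of a chain have a least one. This is where finiteness of clauses enters
the Zorn argument. -/
theorem exists_mem_chain_disjoint {A : Type*} {c : Set (Set A)} (hc : IsChain (· ⊆ ·) c)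
    (hne : c.Nonempty) (C : List A) (h : ∀ a ∈ C, ∃ X ∈ c, a ∉ X) :
    ∃ X ∈ c, ∀ a ∈ C, a ∉ X := by
  induction C with
  | nil =>
    obtain ⟨X, hX⟩ := hne
    exact ⟨X, hX, by simp⟩
  | cons b C ih =>
    obtain ⟨X, hX, h1⟩ := ih (fun a ha => h a (List.mem_cons_of_mem _ ha))
    obtain ⟨Y, hY, h2⟩ := h b List.mem_cons_self
    rcases hc.total hX hY with hXY | hXY
    · refine ⟨X, hX, fun a ha => ?_⟩
      rcases List.mem_cons.1 ha with rfl | ha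
      · exact fun h => h2 (hXY h)
      · exact h1 a ha
    · refine ⟨Y, hY, fun a ha => ?_⟩
      rcases List.mem_cons.1 ha with rfl | ha
      · exact h2
      · exact fun h => h1 a ha (hXY h)

/-- A set that meets all derived clauses contains one all of whose elements are supported. -/
theorem exists_supported_model (p : Program L V) (X₀ : Set (GAtom L M))
    (h₀ : ∀ C, Derives p M C → ∃ a ∈ C, a ∈ X₀) :
    ∃ X ⊆ X₀, (∀ C, Derives p M C → ∃ a ∈ C, a ∈ X) ∧
      ∀ a ∈ X, ∃ C, Derives p M (C ++ [a]) ∧ ∀ b ∈ C, b ∉ X := by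
  classical
  obtain ⟨X, hX₀, hX⟩ := zorn_superset_nonempty
    {X : Set (GAtom L M) | ∀ C, Derives p M C → ∃ a ∈ C, a ∈ X}
    (fun c hcs hc hne => by
      refine ⟨⋂₀ c, fun C hC => ?_, fun s hs => Set.sInter_subset_of_mem hs⟩
      by_contra hcon
      push Not at hcon
      obtain ⟨X, hX, hd⟩ := exists_mem_chain_disjoint hc hne C (fun a ha => by
        simpa using hcon a ha)
      obtain ⟨a, ha, h⟩ := hcs hX C hC
      exact hd a ha h) X₀ h₀
  refine ⟨X, hX₀, hX.prop, fun a ha => ?_⟩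
  by_contra hcon
  push Not at hcon
  -- If `a` is unsupported relative to `X`, any derived clause containing `a` has another atom in
  -- `X`, so `a` can be removed, against minimality. Filtering `a` out and appending it once leaves
  -- the clause unchanged as a set, so `congr` applies.
  have hm : X \ {a} ∈ {X : Set (GAtom L M) | ∀ C, Derives p M C → ∃ a ∈ C, a ∈ X} := by
    intro C hC
    by_cases haC : a ∈ C
    · obtain ⟨b, hb, hbX⟩ := hcon (C.filter (· ≠ a)) (hC.congr _ _ (fun b => by
        by_cases hba : b = a
        · simp [hba, haC]
        · simp [hba]))
      rw [List.mem_filter] at hb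
      exact ⟨b, hb.1, hbX, by simpa using hb.2⟩
    · obtain ⟨b, hb, hbX⟩ := hX.prop C hC
      exact ⟨b, hb, hbX, fun h => haC (by rw [← Set.mem_singleton_iff.1 h]; exact hb)⟩
  exact (hX.le_of_le hm Set.sdiff_subset ha).2 rfl

/-- Stable models are the interpretations that satisfy all derived clauses and whose intensional
atoms are all supported. -/
theorem Program.SM_iff_supported (p : Program L V) :
    p.SM M ↔ (∀ C, Derives p M C → ∃ a ∈ C, (structInterp L M).Sat a) ∧
      ∀ a : GAtom L M, a.1 ∈ p.intensional → (structInterp L M).Sat a →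
        Supported p (structInterp L M) a := by
  constructor
  · rintro ⟨hm, hmin⟩
    have hD : ∀ C, Derives p M C → ∃ a ∈ C, (structInterp L M).Sat a :=
      fun C hC => hC.sound p.fixes_structInterp hm
    refine ⟨hD, fun a haτ ha => ?_⟩
    by_contra hcon
    -- The true atoms other than `a` meet every derived clause: a clause they miss would consist of
    -- `a` and false atoms, and would support `a`.
    obtain ⟨X, hX, hXD, hXS⟩ := exists_supported_model p
      {b : GAtom L M | (structInterp L M).Sat b ∧ b ≠ a} (fun C hC => by
        classical
        by_contra hn
        push Not at hn
        refine hcon ⟨C.filter (· ≠ a), hC.congr _ _ (fun b => ?_), fun b hb hs => ?_⟩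
        · have haC : a ∈ C := by
            obtain ⟨b, hb, hs⟩ := hD C hC
            by_cases h : b = a
            · exact h ▸ hb
            · exact absurd ⟨hs, h⟩ (hn b hb)
          by_cases hba : b = a
          · simp [hba, haC]
          · simp [hba]
        · rw [List.mem_filter] at hb
          exact hn b hb.1 ⟨hs, by simpa using hb.2⟩)
    let I : Interp L M := fun P b => (⟨P, b⟩ : GAtom L M) ∈ X
    have hI : ∀ b : GAtom L M, b.1 ∈ p.intensional → ((p.star I).Sat b ↔ b ∈ X) := by
      intro b hb
      rw [Interp.Sat, p.star_of_mem hb]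
    refine hmin I ⟨fun P _ b hb => (hX hb).1, fun h => ?_⟩
      (holds_of_supported (p.fixes_star I) (fun C hC => ?_) (fun b hb hs => ?_))
    · exact (hX (h a.1 haτ a.2 ha)).2 rfl
    · obtain ⟨b, hb, hbX⟩ := hXD C hC
      exact ⟨b, hb, (hI b (hC.pred_mem b hb)).2 hbX⟩
    · obtain ⟨C, hC, hCX⟩ := hXS b ((hI b hb).1 hs)
      exact ⟨C, hC, fun d hd hds =>
        hCX d hd ((hI d (hC.pred_mem d (List.mem_append_left _ hd))).1 hds)⟩
  · rintro ⟨hD, hS⟩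
    refine ⟨holds_of_supported p.fixes_structInterp hD hS, fun I hI hm => hI.2 ?_⟩
    intro P hP a ha
    -- The smaller interpretation satisfies the clause supporting the atom, and the side atoms,
    -- being false in the structure, are false there too. So it cannot drop the atom.
    obtain ⟨C, hC, hCs⟩ := hS ⟨P, a⟩ hP ha
    obtain ⟨b, hb, hbs⟩ := hC.sound (p.fixes_star I) hm
    have hbτ := hC.pred_mem b hb
    rw [Interp.Sat, p.star_of_mem hbτ] at hbs
    rw [List.mem_append, List.mem_singleton] at hb
    rcases hb with hb | rfl
    · exact absurd (hI.1 _ hbτ _ hbs) (hCs b hb)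
    · exact hbs

end Ground

/-! ### Finiteness, normality and intensional predicates of the translation -/

section Syntactic

variable {L : FirstOrder.Language.{u, v}} {V : Type w} {p : Program L V}

theorem Literal.finite_preds (l : Literal L V) : l.preds.Finite := by
  cases l <;> simp [Literal.preds]

theorem Program.finite_preds (hp : p.Finite) : p.preds.Finite := by
  have h : p.preds ⊆ ⋃ γ ∈ p, ((⋃ l ∈ {l | l ∈ γ.body}, l.preds) ∪
      PAtom.pred '' {a | a ∈ γ.head}) := by
    rintro P ⟨γ, hγ, h⟩
    simp only [Set.mem_iUnion, Set.mem_union]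
    refine ⟨γ, hγ, ?_⟩
    rcases h with ⟨l, hl, h⟩ | ⟨a, ha, rfl⟩
    · exact Or.inl ⟨l, hl, h⟩
    · exact Or.inr ⟨a, ha, rfl⟩
  refine Set.Finite.subset (hp.biUnion fun γ _ => Set.Finite.union ?_ ?_) h
  · exact (List.finite_toSet γ.body).biUnion fun l _ => l.finite_preds
  · exact (List.finite_toSet γ.head).image _

theorem Program.intensional_subset_preds : p.intensional ⊆ p.preds :=
  fun _ ⟨γ, hγ, a, ha, h⟩ => ⟨γ, hγ, Or.inr ⟨a, ha, h⟩⟩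

theorem finite_newFun (hp : p.Finite) : Finite (NewFun p 0) := by
  have := (Program.finite_preds hp).to_subtype
  refine Finite.of_surjective (fun o : Option p.preds =>
    match o with
    | none => NewFun.eps
    | some P => NewFun.flag P.1 P.2) ?_
  intro c
  cases c with
  | eps => exact ⟨none, rfl⟩
  | flag P h => exact ⟨some ⟨P, h⟩, rfl⟩

theorem finite_setOf_exists_mem_eq {A B : Type*} {S : Set A} (hS : S.Finite) (f : A → B) :
    {b | ∃ a ∈ S, b = f a}.Finite := by
  refine (hS.image f).subset ?_
  rintro b ⟨a, ha, rfl⟩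
  exact ⟨a, ha, rfl⟩

theorem diamond_finite (hp : p.Finite) : (diamond p).Finite := by
  have := finite_newFun hp
  have hτ : p.intensional.Finite :=
    (Program.finite_preds hp).subset Program.intensional_subset_preds
  unfold diamond
  refine ((((?_ : Set.Finite _).union ?_).union ?_).union ?_).union ?_
  · unfold prog₁
    refine (Set.Finite.union ?_ ?_).union (Set.toFinite _)
    · refine (Set.finite_range fun c : NewFun p 0 =>
        ruleBot p (.pos (encA p (nv p .x) (nv p .y) (cst p c))) []).subset ?_
      rintro γ ⟨c, rfl⟩
      exact ⟨c, rfl⟩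
    · refine (Set.finite_range fun c : NewFun p 0 × NewFun p 0 =>
        ruleBot p (.eq (cst p c.1) (cst p c.2)) []).subset ?_
      rintro γ ⟨c, d, -, rfl⟩
      exact ⟨(c, d), rfl⟩
  · unfold prog₂
    exact Set.toFinite _
  · exact (Set.finite_singleton _).union (finite_setOf_exists_mem_eq hp _)
  · exact (Set.finite_singleton _).union (finite_setOf_exists_mem_eq hτ _)
  · exact (Set.finite_singleton _).union (finite_setOf_exists_mem_eq hτ _)

/-- Case analysis on the rules of the translated program. -/
theorem diamond_forall {Q : Rule (bigLang p) (DVar V) → Prop} :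
    (∀ γ ∈ diamond p, Q γ) ↔ (∀ γ ∈ prog₁ p, Q γ) ∧ (∀ γ ∈ prog₂ p, Q γ) ∧
      (∀ γ ∈ prog₃ p, Q γ) ∧ (∀ γ ∈ prog₄ p, Q γ) ∧ ∀ γ ∈ prog₅ p, Q γ := by
  simp only [diamond, Set.mem_union, or_imp, forall_and, and_assoc]

theorem diamond_isNormal : (diamond p).IsNormal := by
  unfold Program.IsNormal
  rw [diamond_forall]
  refine ⟨?_, ?_, ?_, ?_, ?_⟩
  · rintro γ ((⟨c, rfl⟩ | ⟨c, d, -, rfl⟩) | h)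
    · simp [ruleBot]
    · simp [ruleBot]
    · simp only [Set.mem_insert_iff, Set.mem_singleton_iff] at h
      rcases h with rfl | rfl | rfl | rfl | rfl | rfl | rfl <;> simp [ruleBot, ruleTo]
  · intro γ h
    simp only [prog₂, Set.mem_insert_iff, Set.mem_singleton_iff] at h
    rcases h with rfl | rfl | rfl | rfl | rfl | rfl | rfl <;> simp [ruleTo]
  · rintro γ (rfl | ⟨δ, -, rfl⟩) <;> simp [simRule, ruleTo]
  · rintro γ (rfl | ⟨P, -, rfl⟩) <;> simp [ruleTo]
  · rintro γ (rfl | ⟨P, -, rfl⟩) <;> simp [ruleTo, ruleBot]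

/-- An old predicate as a predicate of the translated program. -/
def oldPred (p : Program L V) (P : Pred L) : Pred (bigLang p) := ⟨P.1, Sum.inl P.2⟩

/-- A new predicate as a predicate of the translated program. -/
def newPred (p : Program L V) {n : ℕ} (R : NewRel.{v} n) : Pred (bigLang p) := ⟨n, Sum.inr R⟩

theorem oldPred_injective : Function.Injective (oldPred p) := by
  rintro ⟨m, P⟩ ⟨n, Q⟩ h
  have hm : m = n := congrArg Sigma.fst h
  subst hm
  have h2 := eq_of_heq (Sigma.mk.inj h).2
  exact congrArg _ (Sum.inl.inj h2)

/-- Together with `newPred_mem_intensional` this determines what minimization may change: all new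
predicates, and among the old ones only those intensional in `p`. -/
theorem oldPred_mem_intensional {P : Pred L} :
    oldPred p P ∈ (diamond p).intensional ↔ P ∈ p.intensional := by
  constructor
  · have key : ∀ γ ∈ diamond p, ∀ a ∈ γ.head, a.pred = oldPred p P → P ∈ p.intensional := by
      have hn : ∀ {n : ℕ} (R : NewRel.{v} n), newPred p R ≠ oldPred p P := by
        rintro n R h
        have hm : n = P.1 := congrArg Sigma.fst h
        subst hm
        have h2 := eq_of_heq (Sigma.mk.inj h).2
        cases h2
      rw [diamond_forall]
      refine ⟨?_, ?_, ?_, ?_, ?_⟩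
      · rintro γ ((⟨c, rfl⟩ | ⟨c, d, -, rfl⟩) | h) a ha hP
        · simp [ruleBot] at ha
        · simp [ruleBot] at ha
        · simp only [Set.mem_insert_iff, Set.mem_singleton_iff] at h
          rcases h with rfl | rfl | rfl | rfl | rfl | rfl | rfl <;>
            simp only [ruleBot, ruleTo, List.mem_singleton, List.not_mem_nil] at ha <;>
            subst ha <;> exact absurd hP (hn _)
      · intro γ h a ha hP
        simp only [prog₂, Set.mem_insert_iff, Set.mem_singleton_iff] at h
        rcases h with rfl | rfl | rfl | rfl | rfl | rfl | rfl <;>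
          simp only [ruleTo, List.mem_singleton] at ha <;>
          subst ha <;> exact absurd hP (hn _)
      · rintro γ (rfl | ⟨δ, -, rfl⟩) a ha hP <;>
          simp only [simRule, ruleTo, List.mem_singleton] at ha <;>
          subst ha <;> exact absurd hP (hn _)
      · rintro γ (rfl | ⟨Q, -, rfl⟩) a ha hP <;>
          simp only [ruleTo, List.mem_singleton] at ha <;>
          subst ha <;> exact absurd hP (hn _)
      · rintro γ (rfl | ⟨Q, hQ, rfl⟩) a ha hP
        · simp [ruleBot] at ha
        · simp only [ruleTo, List.mem_singleton] at ha
          subst ha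
          exact oldPred_injective (p := p) hP ▸ hQ
    rintro ⟨γ, hγ, a, ha, h⟩
    exact key γ hγ a ha h
  · intro h
    exact ⟨_, Or.inr (Or.inr ⟨P, h, rfl⟩), _, List.mem_singleton_self _, rfl⟩

theorem newPred_mem_intensional {n : ℕ} (R : NewRel.{v} n) :
    newPred p R ∈ (diamond p).intensional := by
  cases R
  · exact ⟨_, Or.inl (Or.inl (Or.inl (Or.inl (Or.inr (Or.inl rfl))))), _,
      List.mem_singleton_self _, rfl⟩
  · exact ⟨_, Or.inl (Or.inl (Or.inl (Or.inl (Or.inr (Or.inr (Or.inl rfl)))))), _,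
      List.mem_singleton_self _, rfl⟩
  · exact ⟨_, Or.inl (Or.inl (Or.inl (Or.inl (Or.inr (Or.inr (Or.inr (Or.inr (Or.inr
      (Or.inl rfl))))))))), _, List.mem_singleton_self _, rfl⟩
  · exact ⟨_, Or.inl (Or.inl (Or.inl (Or.inr (Or.inl rfl)))), _,
      List.mem_singleton_self _, rfl⟩
  · exact ⟨_, Or.inl (Or.inl (Or.inl (Or.inr (Or.inr (Or.inr (Or.inl rfl)))))), _,
      List.mem_singleton_self _, rfl⟩
  · exact ⟨_, Or.inl (Or.inl (Or.inl (Or.inr (Or.inr (Or.inr (Or.inr (Or.inr (Or.inl rfl)))))))),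
      _, List.mem_singleton_self _, rfl⟩
  · exact ⟨_, Or.inl (Or.inl (Or.inl (Or.inr (Or.inr (Or.inr (Or.inr (Or.inr (Or.inr
      (Or.inr rfl))))))))), _, List.mem_singleton_self _, rfl⟩
  · exact ⟨_, Or.inl (Or.inl (Or.inr (Or.inl rfl))), _, List.mem_singleton_self _, rfl⟩
  · exact ⟨_, Or.inl (Or.inr (Or.inl rfl)), _, List.mem_singleton_self _, rfl⟩

theorem pred_cases (P : Pred (bigLang p)) :
    (∃ Q, P = oldPred p Q) ∨ ∃ (n : ℕ) (R : NewRel.{v} n), P = newPred p R := by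
  rcases P with ⟨n, Q | R⟩
  · exact Or.inl ⟨⟨n, Q⟩, rfl⟩
  · exact Or.inr ⟨n, R, rfl⟩

end Syntactic

/-! ### Semantics of the atoms and rules of the translation -/

section Semantics

variable {L : FirstOrder.Language.{u, v}} {V : Type w} {p : Program L V} {M : Type x}
  [L.Structure M] [(newLang p).Structure M]

/-- The interpretation with given values for the old and for the new predicates. -/
def joinInterp (p : Program L V) (O : Interp L M)
    (N : ∀ {n : ℕ}, NewRel.{v} n → (Fin n → M) → Prop) : Interp (bigLang p) M :=
  fun P => match P.2 with
    | Sum.inl Q => O ⟨P.1, Q⟩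
    | Sum.inr R => N R

/-- The value of a new individual constant. -/
def flagVal (M : Type x) [(newLang p).Structure M] (c : NewFun p 0) : M :=
  FirstOrder.Language.Structure.funMap (L := newLang p) (M := M) (n := 0) c Fin.elim0

theorem realize_cst (c : NewFun p 0) (α : DVar V → M) : (cst p c).realize α = flagVal M c := by
  have h : (fun i : Fin 0 => ((Fin.elim0 i : DTerm p)).realize α) = Fin.elim0 :=
    funext fun i => i.elim0
  exact (congrArg (FirstOrder.Language.Structure.funMap (L := newLang p) (n := 0) c) h)

theorem realize_liftT (t : L.Term V) (α : DVar V → M) :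
    (liftT p t).realize α = t.realize (α ∘ DVar.old) := by
  unfold liftT
  rw [FirstOrder.Language.LHom.realize_onTerm, FirstOrder.Language.Term.realize_relabel]

theorem realize_nv (l : Letter) (i : ℕ) (α : DVar V → M) :
    (nv p l i).realize α = α (.new l i 0) := rfl

theorem structInterp_oldPred (P : Pred L) :
    structInterp (bigLang p) M (oldPred p P) = structInterp L M P := by
  exact FirstOrder.Language.relMap_sumInl P.2

theorem vec1_eq {A B : Type*} (f : A → B) (a : A) : (fun i => f (![a] i)) = ![f a] := by
  funext i; fin_cases i; rfl

theorem vec2_eq {A B : Type*} (f : A → B) (a b : A) :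
    (fun i => f (![a, b] i)) = ![f a, f b] := by
  funext i; fin_cases i <;> rfl

theorem vec3_eq {A B : Type*} (f : A → B) (a b c : A) :
    (fun i => f (![a, b, c] i)) = ![f a, f b, f c] := by
  funext i; fin_cases i <;> rfl

variable (K : Interp (bigLang p) M) (α : DVar V → M)

theorem encA_holds (s t r : DTerm p) : (encA p s t r).Holds K α ↔
    K (newPred p .enc) ![s.realize α, t.realize α, r.realize α] := by
  rw [← vec3_eq (fun t : DTerm p => t.realize α)]; rfl

theorem nencA_holds (s t r : DTerm p) : (nencA p s t r).Holds K α ↔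
    K (newPred p .nenc) ![s.realize α, t.realize α, r.realize α] := by
  rw [← vec3_eq (fun t : DTerm p => t.realize α)]; rfl

theorem mrgA_holds (s t r : DTerm p) : (mrgA p s t r).Holds K α ↔
    K (newPred p .mrg) ![s.realize α, t.realize α, r.realize α] := by
  rw [← vec3_eq (fun t : DTerm p => t.realize α)]; rfl

theorem okA_holds (s t : DTerm p) : (okA p s t).Holds K α ↔
    K (newPred p .ok) ![s.realize α, t.realize α] := by
  rw [← vec2_eq (fun t : DTerm p => t.realize α)]; rfl

theorem memA_holds (s t : DTerm p) : (memA p s t).Holds K α ↔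
    K (newPred p .mem) ![s.realize α, t.realize α] := by
  rw [← vec2_eq (fun t : DTerm p => t.realize α)]; rfl

theorem subcA_holds (s t : DTerm p) : (subcA p s t).Holds K α ↔
    K (newPred p .subc) ![s.realize α, t.realize α] := by
  rw [← vec2_eq (fun t : DTerm p => t.realize α)]; rfl

theorem equA_holds (s t : DTerm p) : (equA p s t).Holds K α ↔
    K (newPred p .equ) ![s.realize α, t.realize α] := by
  rw [← vec2_eq (fun t : DTerm p => t.realize α)]; rfl

theorem truA_holds (s : DTerm p) : (truA p s).Holds K α ↔
    K (newPred p .tru) ![s.realize α] := by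
  rw [← vec1_eq (fun t : DTerm p => t.realize α)]; rfl

theorem flsA_holds (s : DTerm p) : (flsA p s).Holds K α ↔
    K (newPred p .fls) ![s.realize α] := by
  rw [← vec1_eq (fun t : DTerm p => t.realize α)]; rfl

theorem genAtom_holds (P : Pred L) : (genAtom p P).Holds K α ↔
    K (oldPred p P) (fun i => α (.new .a i 0)) := Iff.rfl

theorem liftLit_holds (l : Literal L V)
    (hK : ∀ a, l = .pos a → K (oldPred p a.pred) = structInterp L M a.pred) :
    (liftLit p l).Holds K α ↔ l.Holds (structInterp L M) (α ∘ DVar.old) := by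
  cases l with
  | pos a =>
    simp only [liftLit, Literal.Holds, PAtom.Holds, realize_liftT]
    exact Iff.of_eq (congrFun (hK a rfl) _)
  | neg a =>
    simp only [liftLit, Literal.Holds, PAtom.Holds, realize_liftT]
    exact not_congr (Iff.of_eq (congrFun (structInterp_oldPred a.pred) _))
  | eq s t => simp only [liftLit, Literal.Holds, realize_liftT]
  | ne s t => simp only [liftLit, Literal.Holds, realize_liftT]

theorem ruleTo_holds (body : List (DLit p)) (h : PAtom (bigLang p) (DVar V)) :
    (ruleTo p body h).Holds K ↔
      ∀ α : DVar V → M, (∀ l ∈ body, l.Holds K α) → h.Holds K α := by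
  simp [Rule.Holds, ruleTo]

theorem ruleBot_holds (b : DLit p) (body : List (DLit p)) :
    (ruleBot p b body).Holds K ↔
      ∀ α : DVar V → M, b.Holds K α → ¬ ∀ l ∈ body, l.Holds K α := by
  simp only [Rule.Holds, ruleBot, List.mem_cons, forall_eq_or_imp]
  simp

/-- The value of the term for `c_P`. -/
noncomputable def predFlag (p : Program L V) (M : Type x) [(newLang p).Structure M]
    (P : Pred L) : M :=
  open Classical in
  if h : P ∈ p.preds then flagVal M (NewFun.flag (p := p) P h) else flagVal M (NewFun.eps (p := p))

theorem realize_flagT (P : Pred L) : (flagT p P).realize α = predFlag p M P := by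
  unfold flagT predFlag
  split_ifs with h
  · exact realize_cst _ _
  · exact realize_cst _ _

theorem encAtom_holds (l : Letter) (i : ℕ) (t₁ : DTerm p) (P : Pred L)
    (r : Fin P.1 → DTerm p) (t₂ : DTerm p) :
    (∀ b ∈ encAtom p l i t₁ P r t₂, b.Holds K α) ↔
      α (.new l i 0) = predFlag p M P ∧
      (∀ j : Fin P.1, K (newPred p .enc)
        ![α (.new l i j), (r j).realize α, α (.new l i (j + 1))]) ∧
      K (newPred p .enc) ![t₁.realize α, α (.new l i P.1), t₂.realize α] := by
  simp only [encAtom, List.forall_mem_append, List.forall_mem_map, List.forall_mem_singleton,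
    List.mem_finRange, forall_const, and_assoc]
  simp only [Literal.Holds, encA_holds, realize_flagT]
  rfl

end Semantics

/-! ### Coding finite sequences by iterated pairing -/

section Codes

variable {A : Type*} {f : A → A → A}

/-- `f` is injective as a function on pairs. -/
def PairInjective (f : A → A → A) : Prop :=
  ∀ ⦃x y x' y'⦄, f x y = f x' y' → x = x' ∧ y = y'

theorem foldl_eq_app (hf : PairInjective f) {c x y : A} (hc : ∀ x y, f x y ≠ c) {l : List A}
    (h : l.foldl f c = f x y) : ∃ l', l = l' ++ [y] ∧ x = l'.foldl f c := by
  rcases List.eq_nil_or_concat l with rfl | ⟨l', b, rfl⟩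
  · exact absurd h.symm (hc x y)
  · rw [List.concat_eq_append, List.foldl_append] at h
    obtain ⟨h1, h2⟩ := hf h
    exact ⟨l', by simp [h2], h1.symm⟩

/-- The last entry is stripped off by injectivity. Since the start values are not pairs, the process
stops at the same moment on both sides. -/
theorem foldl_inj (hf : PairInjective f) {c c' : A} (hc : ∀ x y, f x y ≠ c)
    (hc' : ∀ x y, f x y ≠ c') {l l' : List A} (h : l.foldl f c = l'.foldl f c') :
    c = c' ∧ l = l' := by
  induction l using List.reverseRecOn generalizing l' with
  | nil =>
    rcases List.eq_nil_or_concat l' with rfl | ⟨l', b, rfl⟩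
    · exact ⟨h, rfl⟩
    · rw [List.concat_eq_append, List.foldl_append] at h
      exact absurd h.symm (hc _ _)
  | append_singleton l b ih =>
    rw [List.foldl_append] at h
    obtain ⟨l'', rfl, h2⟩ := foldl_eq_app hf hc' (x := l.foldl f c) (y := b) h.symm
    obtain ⟨h3, rfl⟩ := ih h2
    exact ⟨h3, rfl⟩

/-- The meaning of `in` allows an arbitrary element `x` below the entry `y`; when the whole is a
genuine code, unique decoding still makes `y` an entry of the coded list. -/
theorem mem_of_foldl_eq (hf : PairInjective f) {c x y : A} (hc : ∀ x y, f x y ≠ c)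
    {l l' : List A} (h : l.foldl f c = l'.foldl f (f x y)) : y ∈ l := by
  induction l' using List.reverseRecOn generalizing l with
  | nil =>
    obtain ⟨l'', rfl, -⟩ := foldl_eq_app hf hc h
    simp
  | append_singleton l' b ih =>
    rw [List.foldl_append] at h
    obtain ⟨l'', rfl, h2⟩ := foldl_eq_app hf hc h
    exact List.mem_append_left _ (ih h2.symm)

theorem exists_foldl_eq_of_mem (c : A) {y : A} {l : List A} (h : y ∈ l) :
    ∃ x l', l.foldl f c = List.foldl f (f x y) l' := by
  obtain ⟨s, t, rfl⟩ := List.append_of_mem h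
  exact ⟨s.foldl f c, t, by simp⟩

theorem exists_map_eq_of_forall_mem {B : Type*} (g : B → A) (C : List B) (l : List A)
    (h : ∀ v ∈ l, ∃ b ∈ C, g b = v) : ∃ C' : List B, C'.map g = l ∧ ∀ b ∈ C', b ∈ C := by
  induction l with
  | nil => exact ⟨[], rfl, by simp⟩
  | cons v l ih =>
    obtain ⟨C', rfl, h1⟩ := ih fun v hv => h v (List.mem_cons_of_mem _ hv)
    obtain ⟨b, hb, rfl⟩ := h v List.mem_cons_self
    exact ⟨b :: C', rfl, by simpa [hb] using h1⟩

theorem foldl_flatMap_range {c : ℕ → A} {l : ℕ → List A} {k : ℕ}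
    (h : ∀ i < k, c (i + 1) = (l i).foldl f (c i)) :
    c k = ((List.range k).flatMap l).foldl f (c 0) := by
  induction k with
  | zero => rfl
  | succ k ih =>
    rw [h k (Nat.lt_succ_self k), ih fun i hi => h i (Nat.lt_succ_of_lt hi), List.range_succ,
      List.flatMap_append, List.foldl_append]
    simp

theorem foldl_take_getElem (l : List A) (c : A) {j : ℕ} (h : j < l.length) :
    (l.take (j + 1)).foldl f c = f ((l.take j).foldl f c) l[j] := by
  rw [← List.take_append_getElem h, List.foldl_append]
  rfl

theorem foldl_of_steps (l : List A) {c : ℕ → A}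
    (h : ∀ (j : ℕ) (hj : j < l.length), c (j + 1) = f (c j) l[j]) :
    c l.length = l.foldl f (c 0) := by
  have key : ∀ j ≤ l.length, c j = (l.take j).foldl f (c 0) := by
    intro j
    induction j with
    | zero => intro _; rfl
    | succ j ih =>
      intro hj
      rw [h j hj, ih (Nat.le_of_succ_le hj), foldl_take_getElem l _ hj]
  simpa using key l.length le_rfl

theorem forall_mem_flatMap_zipIdx {B : Type*} (l : List B) (g : B × ℕ → List A) (Q : A → Prop) :
    (∀ a ∈ l.zipIdx.flatMap g, Q a) ↔
      ∀ (i : ℕ) (h : i < l.length), ∀ a ∈ g (l[i], i), Q a := by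
  simp only [List.mem_flatMap, forall_exists_index, and_imp, Prod.forall,
    List.mk_mem_zipIdx_iff_getElem?]
  constructor
  · intro h i hi a ha
    exact h a _ i (List.getElem?_eq_getElem hi) ha
  · intro h a b i hb ha
    obtain ⟨hi, rfl⟩ := List.getElem?_eq_some_iff.1 hb
    exact h i hi a ha

end Codes

/-! ### Codes of atoms and clauses, and the intended meaning of the new predicates -/

section Spec

variable {L : FirstOrder.Language.{u, v}} {V : Type w} {p : Program L V} {M : Type x}
  [L.Structure M] [(newLang p).Structure M]

variable (p M) in
/-- `enc` is interpreted by the graph of `f`, which is an encoding of pairs that avoids the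
flags. -/
structure IsEncoding (f : M → M → M) : Prop where
  enc : ∀ a : Fin 3 → M, structInterp (bigLang p) M (newPred p .enc) a ↔ f (a 0) (a 1) = a 2
  nenc : ∀ a : Fin 3 → M, structInterp (bigLang p) M (newPred p .nenc) a ↔ ¬ f (a 0) (a 1) = a 2
  ok : ∀ a : Fin 2 → M, structInterp (bigLang p) M (newPred p .ok) a
  inj : PairInjective f
  ne_flag : ∀ (c : NewFun p 0) (x y : M), f x y ≠ flagVal M c
  flag_inj : Function.Injective (flagVal M : NewFun p 0 → M)

variable (p M) in
/-- The value of `c_ε`. -/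
abbrev epsVal : M :=
  flagVal M (NewFun.eps (p := p))

variable (p) in
/-- The code of a ground atom. -/
noncomputable def atomCode (f : M → M → M) (a : GAtom L M) : M :=
  (List.ofFn a.2).foldl f (predFlag p M a.1)

variable (p) in
/-- The code of a clause. -/
noncomputable def clauseCode (f : M → M → M) (C : List (GAtom L M)) : M :=
  (C.map (atomCode p f)).foldl f (epsVal p M)

variable (p) in
/-- The intended meaning of the new predicates. -/
def newSpec (f : M → M → M) : ∀ {n : ℕ}, NewRel.{v} n → (Fin n → M) → Prop
  | 3, .enc, a => f (a 0) (a 1) = a 2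
  | 3, .nenc, a => ¬ f (a 0) (a 1) = a 2
  | 2, .ok, _ => True
  | 3, .mrg, a => ∃ l : List M, a 1 = l.foldl f (epsVal p M) ∧ a 2 = l.foldl f (a 0)
  | 2, .mem, a => ∃ (x : M) (l : List M), a 1 = l.foldl f (f x (a 0))
  | 2, .subc, a => ∃ l : List M, a 0 = l.foldl f (epsVal p M) ∧
      ∀ v ∈ l, ∃ (x : M) (l' : List M), a 1 = l'.foldl f (f x v)
  | 2, .equ, a => (∃ l : List M, a 0 = l.foldl f (epsVal p M) ∧
      ∀ v ∈ l, ∃ (x : M) (l' : List M), a 1 = l'.foldl f (f x v)) ∧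
      ∃ l : List M, a 1 = l.foldl f (epsVal p M) ∧
      ∀ v ∈ l, ∃ (x : M) (l' : List M), a 0 = l'.foldl f (f x v)
  | 1, .tru, a => ∃ C, Derives p M C ∧ a 0 = clauseCode p f C
  | 1, .fls, a => ∃ C, a 0 = clauseCode p f C ∧
      ∀ b ∈ C, b.1 ∈ p.intensional ∧ ¬ (structInterp L M).Sat b

variable (p) in
/-- The intended meaning of the intensional predicates of the translated program. -/
def spec (f : M → M → M) : Interp (bigLang p) M :=
  joinInterp p (fun P a => Supported p (structInterp L M) ⟨P, a⟩) (newSpec p f)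

omit [L.Structure M] in
theorem predFlag_of_mem {P : Pred L} (h : P ∈ p.preds) :
    predFlag p M P = flagVal M (NewFun.flag (p := p) P h) := by
  simp [predFlag, h]

variable {f : M → M → M}

theorem IsEncoding.ne_predFlag (hf : IsEncoding p M f) (P : Pred L) (x y : M) :
    f x y ≠ predFlag p M P := by
  unfold predFlag
  split_ifs
  · exact hf.ne_flag _ x y
  · exact hf.ne_flag _ x y

/-- Intensional predicates occur in the program, so their flags are genuine and pairwise distinct;
the default flag `c_ε` of `predFlag` never interferes. -/
theorem IsEncoding.atomCode_inj (hf : IsEncoding p M f) {a b : GAtom L M}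
    (ha : a.1 ∈ p.intensional) (hb : b.1 ∈ p.intensional)
    (h : atomCode p f a = atomCode p f b) : a = b := by
  obtain ⟨h1, h2⟩ := foldl_inj hf.inj (hf.ne_predFlag a.1) (hf.ne_predFlag b.1) h
  rw [predFlag_of_mem (Program.intensional_subset_preds ha),
    predFlag_of_mem (Program.intensional_subset_preds hb)] at h1
  have h3 := hf.flag_inj h1
  obtain ⟨P, a⟩ := a
  obtain ⟨Q, b⟩ := b
  have h4 : P = Q := by injection h3
  subst h4
  exact congrArg _ (List.ofFn_injective h2)

theorem IsEncoding.clauseCode_eq_app (hf : IsEncoding p M f) {C : List (GAtom L M)} {x y : M}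
    (h : clauseCode p f C = f x y) :
    ∃ C' a, C = C' ++ [a] ∧ x = clauseCode p f C' ∧ y = atomCode p f a := by
  obtain ⟨l, h1, h2⟩ := foldl_eq_app hf.inj (hf.ne_flag _) h
  rcases List.eq_nil_or_concat C with rfl | ⟨C', b, rfl⟩
  · simp at h1
  · rw [List.concat_eq_append, List.map_append, List.map_singleton] at h1
    obtain ⟨rfl, h3⟩ := List.append_inj' h1 rfl
    exact ⟨C', b, by simp, h2, by simpa using h3.symm⟩

omit [L.Structure M] in
theorem clauseCode_append (C : List (GAtom L M)) (a : GAtom L M) :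
    clauseCode p f (C ++ [a]) = f (clauseCode p f C) (atomCode p f a) := by
  simp [clauseCode]

theorem IsEncoding.clauseCode_inj (hf : IsEncoding p M f) {C : List (GAtom L M)} {l : List M}
    (h : clauseCode p f C = l.foldl f (epsVal p M)) : l = C.map (atomCode p f) :=
  (foldl_inj hf.inj (hf.ne_flag _) (hf.ne_flag _) h).2.symm

/-- The codes of equal clauses, as sets, are closed under derivability. -/
theorem IsEncoding.derives_of_equ (hf : IsEncoding p M f) {C : List (GAtom L M)}
    (hC : Derives p M C) {x y : M} (hx : x = clauseCode p f C)
    (h : newSpec p f .equ ![x, y]) : ∃ C', Derives p M C' ∧ y = clauseCode p f C' := by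
  obtain ⟨⟨l, h1, h2⟩, l', h3, h4⟩ := h
  simp only [Matrix.cons_val_zero, Matrix.cons_val_one] at h1 h2 h3 h4
  rw [hx] at h1
  obtain rfl := hf.clauseCode_inj h1
  -- Every entry of the code `y` is an entry of the code of `C`, hence the code of an atom of `C`;
  -- so `y` is itself the code of a clause.
  obtain ⟨C', rfl, h5⟩ := exists_map_eq_of_forall_mem (atomCode p f) C l' (fun v hv => by
    obtain ⟨z, l'', h6⟩ := h4 v hv
    rw [hx] at h6
    exact List.mem_map.1 (mem_of_foldl_eq hf.inj (hf.ne_flag _) h6))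
  refine ⟨C', hC.congr _ _ fun a => ⟨fun ha => ?_, h5 a⟩, h3⟩
  obtain ⟨z, l'', h6⟩ := h2 _ (List.mem_map_of_mem ha)
  rw [h3] at h6
  obtain ⟨b, hb, h7⟩ := List.mem_map.1 (mem_of_foldl_eq hf.inj (hf.ne_flag _) h6)
  rwa [← hf.atomCode_inj (hC.pred_mem b (h5 b hb)) (hC.pred_mem a ha) h7]

/-- The body of the rule that simulates `γ`, spelled out. -/
theorem simRule_holds (K : Interp (bigLang p) M) (γ : Rule L V) :
    (simRule p γ).Holds K ↔ ∀ α : DVar V → M,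
      (∀ i < (posInt p γ).length, K (newPred p .tru) ![α (.new .x (i + 1) 0)]) →
      (∀ (i : ℕ) (h : i < (posInt p γ).length),
        ∀ b ∈ encAtom p .u (i + 1) (nv p .y (i + 1)) (posInt p γ)[i].pred
          (fun j => liftT p ((posInt p γ)[i].args j)) (nv p .x (i + 1)), b.Holds K α) →
      (∀ (i : ℕ) (h : i < γ.head.length),
        ∀ b ∈ encAtom p .s i (nv p .v i) γ.head[i].pred
          (fun j => liftT p (γ.head[i].args j)) (nv p .v (i + 1)), b.Holds K α) →
      (∀ i < (posInt p γ).length, K (newPred p .mrg)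
        ![α (.new .w i 0), α (.new .y (i + 1) 0), α (.new .w (i + 1) 0)]) →
      α (.new .v 0 0) = epsVal p M →
      α (.new .w 0 0) = α (.new .v γ.head.length 0) →
      α (.new .z 0 0) = α (.new .w (posInt p γ).length 0) →
      (∀ l ∈ restBody p γ, (liftLit p l).Holds K α) →
      K (newPred p .tru) ![α (.new .z 0 0)] := by
  unfold simRule
  rw [ruleTo_holds]
  refine forall_congr' fun α => ?_
  simp only [mrgHead, List.forall_mem_append, List.forall_mem_map, forall_mem_flatMap_zipIdx,
    List.mem_range, List.forall_mem_cons, List.not_mem_nil, IsEmpty.forall_iff, implies_true,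
    and_true, and_imp, truA_holds]
  simp only [Literal.Holds, truA_holds, mrgA_holds, realize_nv, epsT, realize_cst]

/-- What the conjunction for `enc(t₁, ⌈P(r)⌉, t₂)` says. -/
theorem encAtom_value {K : Interp (bigLang p) M}
    (hK : ∀ a : Fin 3 → M, K (newPred p .enc) a → f (a 0) (a 1) = a 2) {α : DVar V → M} {l : Letter} {i : ℕ}
    {t₁ t₂ : DTerm p} {P : Pred L} {r : Fin P.1 → DTerm p}
    (h : ∀ b ∈ encAtom p l i t₁ P r t₂, b.Holds K α) :
    f (t₁.realize α) (atomCode p f ⟨P, fun j => (r j).realize α⟩) = t₂.realize α := by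
  obtain ⟨h1, h2, h3⟩ := (encAtom_holds K α l i t₁ P r t₂).1 h
  have h4 := hK _ h3
  simp only [Matrix.cons_val_zero, Matrix.cons_val_one, Matrix.cons_val_two, Matrix.head_cons,
    Matrix.tail_cons] at h4
  rw [← h4]
  congr 1
  have h5 := foldl_of_steps (f := f) (List.ofFn fun j => (r j).realize α)
    (c := fun j => α (.new l i j)) (fun j hj => by
      have := hK _ (h2 ⟨j, by simpa using hj⟩)
      simpa using this.symm)
  simp only [List.length_ofFn, h1] at h5
  exact h5.symm

/-- A way to satisfy the conjunction for `enc(t₁, ⌈P(r)⌉, t₂)`. -/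
theorem encAtom_intro {K : Interp (bigLang p) M}
    (hK : ∀ a : Fin 3 → M, f (a 0) (a 1) = a 2 → K (newPred p .enc) a) {α : DVar V → M} {l : Letter} {i : ℕ}
    {t₁ t₂ : DTerm p} {P : Pred L} {r : Fin P.1 → DTerm p}
    (h : ∀ j, α (.new l i j) =
      ((List.ofFn fun j => (r j).realize α).take j).foldl f (predFlag p M P))
    (ht : f (t₁.realize α) (atomCode p f ⟨P, fun j => (r j).realize α⟩) = t₂.realize α) :
    ∀ b ∈ encAtom p l i t₁ P r t₂, b.Holds K α := by
  rw [encAtom_holds]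
  refine ⟨by simp [h], fun j => hK _ ?_, hK _ ?_⟩
  · have := foldl_take_getElem (f := f) (List.ofFn fun j => (r j).realize α)
      (predFlag p M P) (j := j) (by simp)
    simp [h, this]
  · simp only [Matrix.cons_val_zero, Matrix.cons_val_one, Matrix.cons_val]
    rw [← ht, h]
    congr 1
    unfold atomCode
    congr 1
    rw [List.take_of_length_le (by simp)]

end Spec

/-! ### The intended interpretation satisfies the rules -/

section Model

variable {L : FirstOrder.Language.{u, v}} {V : Type w} {p : Program L V} {M : Type x}
  [L.Structure M] [(newLang p).Structure M] {f : M → M → M}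

omit [L.Structure M] [(newLang p).Structure M] in
/-- A rule is preserved if its head keeps its meaning and the other predicates shrink. -/
theorem Rule.Holds.mono [(bigLang p).Structure M] {γ : Rule (bigLang p) (DVar V)}
    {K K' : Interp (bigLang p) M} (h : γ.Holds K') (hK : ∀ P a, K P a → K' P a)
    (hh : ∀ a ∈ γ.head, K a.pred = K' a.pred) : γ.Holds K := by
  intro α hb
  obtain ⟨a, ha, h1⟩ := h α fun l hl => by
    have h2 := hb l hl
    cases l with
    | pos a => exact hK _ _ h2
    | neg a => exact h2
    | eq s t => exact h2
    | ne s t => exact h2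
  refine ⟨a, ha, ?_⟩
  unfold PAtom.Holds at h1 ⊢
  rwa [hh a ha]

/-- `K` reads the new predicates and the intensional predicates of `p` as intended, and the other
predicates as the structure does. -/
structure IsSpec (f : M → M → M) (K : Interp (bigLang p) M) : Prop where
  new : ∀ {n : ℕ} (R : NewRel.{v} n), K (newPred p R) = newSpec p f R
  old : ∀ P ∈ p.intensional, ∀ a, K (oldPred p P) a ↔ Supported p (structInterp L M) ⟨P, a⟩
  fixed : ∀ P ∉ p.intensional, K (oldPred p P) = structInterp L M P

variable {K : Interp (bigLang p) M}

theorem IsSpec.enc (hK : IsSpec f K) (a : Fin 3 → M) :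
    K (newPred p .enc) a ↔ f (a 0) (a 1) = a 2 := by
  rw [hK.new]; rfl

theorem IsSpec.prog₁_holds (hf : IsEncoding p M f) (hK : IsSpec f K) :
    ∀ γ ∈ prog₁ p, γ.Holds K := by
  rintro γ ((⟨c, rfl⟩ | ⟨c, d, hcd, rfl⟩) | h)
  · rw [ruleBot_holds]
    intro α h
    exact absurd (((hK.enc _).1 h).trans (realize_cst c α)) (hf.ne_flag c _ _)
  · rw [ruleBot_holds]
    intro α h
    simp only [Literal.Holds, realize_cst] at h
    exact absurd (hf.flag_inj h) hcd
  · simp only [Set.mem_insert_iff, Set.mem_singleton_iff] at h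
    rcases h with rfl | rfl | rfl | rfl | rfl | rfl | rfl
    · rw [ruleTo_holds]
      intro α h
      simp only [List.forall_mem_singleton, Literal.Holds, nencA_holds, encA_holds, hf.nenc,
        hK.enc, not_not] at h ⊢
      exact h
    · rw [ruleTo_holds]
      intro α h
      simp only [List.forall_mem_singleton, Literal.Holds, nencA_holds, encA_holds, hf.enc,
        hK.new] at h ⊢
      exact h
    · rw [ruleBot_holds]
      intro α h h'
      simp only [List.forall_mem_cons, Literal.Holds, encA_holds, hK.enc] at h h'
      exact h'.2.1 (hf.inj (h.trans h'.1.symm)).1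
    · rw [ruleBot_holds]
      intro α h h'
      simp only [List.forall_mem_cons, Literal.Holds, encA_holds, hK.enc] at h h'
      exact h'.2.1 (hf.inj (h.trans h'.1.symm)).2
    · rw [ruleTo_holds]
      intro α h
      rw [okA_holds, hK.new]
      exact trivial
    · rw [ruleTo_holds]
      intro α h
      rw [okA_holds, hK.new]
      exact trivial
    · rw [ruleBot_holds]
      intro α h h'
      simp only [List.forall_mem_cons, Literal.Holds, encA_holds, hK.enc] at h h'
      exact h'.2.1 (h.symm.trans h'.1)

theorem IsSpec.prog₂_holds (hK : IsSpec f K) : ∀ γ ∈ prog₂ p, γ.Holds K := by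
  intro γ h
  simp only [prog₂, Set.mem_insert_iff, Set.mem_singleton_iff] at h
  rcases h with rfl | rfl | rfl | rfl | rfl | rfl | rfl <;> rw [ruleTo_holds] <;> intro α h <;>
    simp only [List.forall_mem_cons, List.not_mem_nil, IsEmpty.forall_iff, implies_true,
      and_true, Literal.Holds, encA_holds, hK.enc, epsT, realize_cst, mrgA_holds, memA_holds,
      subcA_holds, equA_holds, hK.new] at h ⊢
  · exact ⟨[], h, rfl⟩
  · obtain ⟨⟨l, h1, h2⟩, h3, h4⟩ := h
    refine ⟨l ++ [α (.new .w 0 0)], ?_, ?_⟩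
    · rw [List.foldl_append]
      exact h3.symm.trans (congrArg (f · _) h1)
    · rw [List.foldl_append]
      exact h4.symm.trans (congrArg (f · _) h2)
  · exact ⟨_, [], h.symm⟩
  · obtain ⟨h1, y, l, h2⟩ := h
    refine ⟨y, l ++ [α (.new .z 0 0)], ?_⟩
    rw [List.foldl_append]
    exact h1.symm.trans (congrArg (f · _) h2)
  · exact ⟨[], h, by simp⟩
  · obtain ⟨⟨l, h1, h2⟩, h3, h4⟩ := h
    refine ⟨l ++ [α (.new .v 0 0)], ?_, ?_⟩
    · rw [List.foldl_append]
      exact h3.symm.trans (congrArg (f · _) h1)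
    · rw [List.forall_mem_append, List.forall_mem_singleton]
      exact ⟨h2, h4⟩
  · exact h

theorem IsSpec.simRule_holds (hf : IsEncoding p M f) (hK : IsSpec f K) {γ : Rule L V}
    (hγ : γ ∈ p) : (simRule p γ).Holds K := by
  rw [DLP.simRule_holds]
  intro α htru hu hs hmrg hv hw hz hrest
  have hβ : ∀ t : L.Term V, (liftT p t).realize α = t.realize (α ∘ DVar.old) :=
    fun t => realize_liftT t α
  have hC : ∀ i : ℕ, ∃ C : List (GAtom L M), ∀ h : i < (posInt p γ).length,
      Derives p M (C ++ [((posInt p γ)[i]).ground (α ∘ DVar.old)]) ∧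
        α (.new .y (i + 1) 0) = clauseCode p f C := by
    intro i
    by_cases h : i < (posInt p γ).length
    · have h1 := htru i h
      rw [hK.new] at h1
      obtain ⟨C, hC, h2⟩ := h1
      have h3 := encAtom_value (fun a => (hK.enc a).1) (hu i h)
      simp only [realize_nv, hβ] at h3
      -- The code of the derived clause is a pair whose second component codes the body atom. So the
      -- body atom is the last atom of the clause and `yᵢ` codes the remainder.
      obtain ⟨C', a, rfl, h4, h5⟩ := hf.clauseCode_eq_app (h2.symm.trans h3.symm)
      have ha : ((posInt p γ)[i]).ground (α ∘ DVar.old) = a :=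
        hf.atomCode_inj (mem_posInt.1 (List.getElem_mem h)).2 (hC.pred_mem a (by simp)) h5
      exact ⟨C', fun _ => ⟨by rwa [ha], h4⟩⟩
    · exact ⟨[], fun h' => absurd h' h⟩
  choose C hC using hC
  have hhead : α (.new .v γ.head.length 0) =
      clauseCode p f (γ.head.map fun a => a.ground (α ∘ DVar.old)) := by
    have h1 := foldl_of_steps (f := f)
      ((γ.head.map fun a => a.ground (α ∘ DVar.old)).map (atomCode p f))
      (c := fun i => α (.new .v i 0)) (fun i hi => by
        have h2 := encAtom_value (fun a => (hK.enc a).1) (hs i (by simpa using hi))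
        simp only [realize_nv, hβ] at h2
        rw [← h2]
        simp [PAtom.ground])
    simp only [List.length_map, hv] at h1
    exact h1
  rw [hK.new]
  refine ⟨_, Derives.rule γ hγ (α ∘ DVar.old) C (fun i h => (hC i h).1) (fun l hl => ?_), ?_⟩
  · refine (liftLit_holds K α l ?_).1 (hrest l hl)
    rintro a rfl
    exact hK.fixed _ ((mem_restBody.1 hl).2 a rfl)
  -- Each `mrg` step appends the entries of `C i` to the accumulator `wᵢ`, which starts with the
  -- code of the head.
  · have h1 := foldl_flatMap_range (f := f) (c := fun i => α (.new .w i 0))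
      (l := fun i => (C i).map (atomCode p f)) (k := (posInt p γ).length) (fun i hi => by
        have h2 := hmrg i hi
        rw [hK.new] at h2
        obtain ⟨l, h3, h4⟩ := h2
        obtain rfl := hf.clauseCode_inj ((hC i hi).2.symm.trans h3)
        exact h4)
    simp only [hw, hhead] at h1
    change α (.new .z 0 0) = _
    rw [hz, h1]
    simp [clauseCode, List.map_flatMap]

theorem IsSpec.prog₃_holds (hf : IsEncoding p M f) (hK : IsSpec f K) :
    ∀ γ ∈ prog₃ p, γ.Holds K := by
  rintro γ (rfl | ⟨δ, hδ, rfl⟩)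
  · rw [ruleTo_holds]
    intro α h
    simp only [List.forall_mem_cons, List.not_mem_nil, IsEmpty.forall_iff, implies_true,
      and_true, Literal.Holds, truA_holds, equA_holds, hK.new] at h ⊢
    obtain ⟨⟨C, hC, h1⟩, h2⟩ := h
    exact hf.derives_of_equ hC h1 h2
  · exact hK.simRule_holds hf hδ

theorem IsSpec.prog₄_holds (hK : IsSpec f K) : ∀ γ ∈ prog₄ p, γ.Holds K := by
  rintro γ (rfl | ⟨P, hP, rfl⟩)
  · rw [ruleTo_holds]
    intro α h
    simp only [List.forall_mem_singleton, Literal.Holds, epsT, realize_cst, flsA_holds,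
      hK.new] at h ⊢
    exact ⟨[], h, by simp⟩
  · rw [ruleTo_holds]
    intro α h
    rw [List.forall_mem_append, List.forall_mem_append, List.forall_mem_singleton,
      List.forall_mem_singleton] at h
    obtain ⟨⟨h1, h2⟩, h3⟩ := h
    replace h2 := encAtom_value (fun a => (hK.enc a).1) h2
    simp only [Literal.Holds, flsA_holds, hK.new, genAtom_holds, structInterp_oldPred]
      at h1 h3 ⊢
    obtain ⟨C, h4, h5⟩ := h1
    refine ⟨C ++ [⟨P, fun j => (argVars p P j).realize α⟩], ?_, ?_⟩
    · rw [clauseCode_append]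
      exact h2.symm.trans (congrArg (f · _) h4)
    · rw [List.forall_mem_append, List.forall_mem_singleton]
      exact ⟨h5, hP, h3⟩

/-- Unique decoding splits the derived clause into the atom `P(z)` and a remainder with code `y`.
Since `y` also codes a clause of false atoms, the remainder is false and supports `P(z)`. -/
theorem IsSpec.prog₅_holds (hf : IsEncoding p M f) (hE : ¬ Derives p M ([] : List (GAtom L M)))
    (hK : IsSpec f K) : ∀ γ ∈ prog₅ p, γ.Holds K := by
  rintro γ (rfl | ⟨P, hP, rfl⟩)
  · rw [ruleBot_holds]
    intro α h
    simp only [Literal.Holds, truA_holds, epsT, realize_cst, hK.new] at h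
    obtain ⟨C, hC, h1⟩ := h
    have h2 := hf.clauseCode_inj (l := []) h1.symm
    rw [List.map_eq_nil_iff.1 h2.symm] at hC
    exact absurd hC hE
  · rw [ruleTo_holds]
    intro α h
    rw [List.forall_mem_append, List.forall_mem_append, List.forall_mem_singleton,
      List.forall_mem_singleton] at h
    obtain ⟨⟨h1, h2⟩, h3⟩ := h
    replace h2 := encAtom_value (fun a => (hK.enc a).1) h2
    simp only [Literal.Holds, flsA_holds, truA_holds, hK.new, genAtom_holds] at h1 h3 ⊢
    rw [hK.old P hP]
    obtain ⟨C, hC, h4⟩ := h1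
    obtain ⟨C', h5, h6⟩ := h3
    obtain ⟨D, a, rfl, h7, h8⟩ := hf.clauseCode_eq_app (h4.symm.trans h2.symm)
    have ha := hf.atomCode_inj (b := a) hP (hC.pred_mem a (by simp)) h8
    have h9 := hf.clauseCode_inj (h7.symm.trans h5)
    refine ⟨D, by rw [← ha] at hC; exact hC, fun b hb hs => ?_⟩
    have h10 : atomCode p f b ∈ C'.map (atomCode p f) := h9 ▸ List.mem_map_of_mem hb
    obtain ⟨c, hc, hcb⟩ := List.mem_map.1 h10
    have hbc := hf.atomCode_inj (h6 c hc).1 (hC.pred_mem b (by simp [hb])) hcb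
    exact (h6 c hc).2 (hbc ▸ hs)

/-- The intended interpretation satisfies the translated program. -/
theorem IsSpec.diamond_holds (hf : IsEncoding p M f)
    (hE : ¬ Derives p M ([] : List (GAtom L M))) (hK : IsSpec f K) :
    ∀ γ ∈ diamond p, γ.Holds K :=
  diamond_forall.2 ⟨hK.prog₁_holds hf, hK.prog₂_holds, hK.prog₃_holds hf, hK.prog₄_holds,
    hK.prog₅_holds hf hE⟩

end Model

/-! ### Every interpretation satisfying the rules contains the intended one -/

section Least

variable {L : FirstOrder.Language.{u, v}} {V : Type w} {p : Program L V} {M : Type x}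
  [L.Structure M] [(newLang p).Structure M] {f : M → M → M} {K : Interp (bigLang p) M}

/-- The assignment with given values for the new variables, by their names. -/
def letterAssign {V : Type w} {M : Type x} (x y z u v w : M) : DVar V → M
  | .new .x _ _ => x
  | .new .y _ _ => y
  | .new .z _ _ => z
  | .new .u _ _ => u
  | .new .v _ _ => v
  | .new .w _ _ => w
  | _ => x

/-- The negated `nenc` is read in the structure, where it is the complement of the graph of `f`; so
in the reduct the choice rule becomes a set of facts. -/
theorem enc_of_holds (hf : IsEncoding p M f) (hK : ∀ γ ∈ prog₁ p, γ.Holds K) (a : Fin 3 → M)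
    (h : f (a 0) (a 1) = a 2) : K (newPred p .enc) a := by
  have h1 := hK _ (Or.inr (Or.inl rfl))
  rw [ruleTo_holds] at h1
  have h2 := h1 (letterAssign (a 0) (a 1) (a 2) (a 0) (a 0) (a 0))
  simp only [List.forall_mem_singleton, Literal.Holds, nencA_holds, encA_holds, hf.nenc,
    not_not] at h2
  have h3 := h2 h
  rwa [show a = ![a 0, a 1, a 2] from by funext i; fin_cases i <;> rfl]

theorem nenc_of_holds (hf : IsEncoding p M f) (hK : ∀ γ ∈ prog₁ p, γ.Holds K) (a : Fin 3 → M)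
    (h : ¬ f (a 0) (a 1) = a 2) : K (newPred p .nenc) a := by
  have h1 := hK _ (Or.inr (Or.inr (Or.inl rfl)))
  rw [ruleTo_holds] at h1
  have h2 := h1 (letterAssign (a 0) (a 1) (a 2) (a 0) (a 0) (a 0))
  simp only [List.forall_mem_singleton, Literal.Holds, nencA_holds, encA_holds, hf.enc] at h2
  have h3 := h2 h
  rwa [show a = ![a 0, a 1, a 2] from by funext i; fin_cases i <;> rfl]

theorem ok_of_holds (hf : IsEncoding p M f) (hK : ∀ γ ∈ prog₁ p, γ.Holds K) (a : Fin 2 → M) :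
    K (newPred p .ok) a := by
  have h1 := hK _ (Or.inr (Or.inr (Or.inr (Or.inr (Or.inr (Or.inl rfl))))))
  rw [ruleTo_holds] at h1
  have h2 := h1 (letterAssign (a 0) (a 1) (f (a 0) (a 1)) (a 0) (a 0) (a 0))
  simp only [List.forall_mem_singleton, Literal.Holds, okA_holds, encA_holds] at h2
  have h3 := h2 (enc_of_holds hf hK _ rfl)
  rwa [show a = ![a 0, a 1] from by funext i; fin_cases i <;> rfl]

theorem mrg_of_holds (hE : ∀ a : Fin 3 → M, f (a 0) (a 1) = a 2 → K (newPred p .enc) a)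
    (hK : ∀ γ ∈ prog₂ p, γ.Holds K) (x : M) (l : List M) :
    K (newPred p .mrg) ![x, l.foldl f (epsVal p M), l.foldl f x] := by
  induction l using List.reverseRecOn with
  | nil =>
    have h1 := hK _ (Or.inl rfl)
    rw [ruleTo_holds] at h1
    have h2 := h1 (letterAssign x (epsVal p M) x x x x)
    simp only [List.forall_mem_singleton, Literal.Holds, mrgA_holds, epsT, realize_cst] at h2
    exact h2 rfl
  | append_singleton l b ih =>
    have h1 := hK _ (Or.inr (Or.inl rfl))
    rw [ruleTo_holds] at h1
    have h2 := h1 (letterAssign x (f (l.foldl f (epsVal p M)) b) (f (l.foldl f x) b)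
      (l.foldl f (epsVal p M)) (l.foldl f x) b)
    simp only [List.forall_mem_cons, List.not_mem_nil, IsEmpty.forall_iff, implies_true,
      and_true, Literal.Holds, mrgA_holds, encA_holds] at h2
    simp only [List.foldl_append]
    exact h2 ⟨ih, hE _ rfl, hE _ rfl⟩

theorem mem_of_holds (hE : ∀ a : Fin 3 → M, f (a 0) (a 1) = a 2 → K (newPred p .enc) a)
    (hK : ∀ γ ∈ prog₂ p, γ.Holds K) (x u : M) (l : List M) :
    K (newPred p .mem) ![u, l.foldl f (f x u)] := by
  induction l using List.reverseRecOn with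
  | nil =>
    have h1 := hK _ (Or.inr (Or.inr (Or.inl rfl)))
    rw [ruleTo_holds] at h1
    have h2 := h1 (letterAssign x (f x u) x u x x)
    simp only [List.forall_mem_singleton, Literal.Holds, memA_holds, encA_holds] at h2
    exact h2 (hE _ rfl)
  | append_singleton l b ih =>
    have h1 := hK _ (Or.inr (Or.inr (Or.inr (Or.inl rfl))))
    rw [ruleTo_holds] at h1
    have h2 := h1 (letterAssign (l.foldl f (f x u)) (f (l.foldl f (f x u)) b) b u x x)
    simp only [List.forall_mem_cons, List.not_mem_nil, IsEmpty.forall_iff, implies_true,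
      and_true, Literal.Holds, memA_holds, encA_holds] at h2
    simp only [List.foldl_append]
    exact h2 ⟨hE _ rfl, ih⟩

theorem subc_of_holds (hE : ∀ a : Fin 3 → M, f (a 0) (a 1) = a 2 → K (newPred p .enc) a)
    (hK : ∀ γ ∈ prog₂ p, γ.Holds K) (y : M) (l : List M)
    (h : ∀ v ∈ l, ∃ (x : M) (l' : List M), y = l'.foldl f (f x v)) :
    K (newPred p .subc) ![l.foldl f (epsVal p M), y] := by
  induction l using List.reverseRecOn with
  | nil =>
    have h1 := hK _ (Or.inr (Or.inr (Or.inr (Or.inr (Or.inl rfl)))))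
    rw [ruleTo_holds] at h1
    have h2 := h1 (letterAssign (epsVal p M) y y y y y)
    simp only [List.forall_mem_singleton, Literal.Holds, subcA_holds, epsT, realize_cst] at h2
    exact h2 rfl
  | append_singleton l b ih =>
    rw [List.forall_mem_append, List.forall_mem_singleton] at h
    obtain ⟨hl, x, l', rfl⟩ := h
    have h1 := hK _ (Or.inr (Or.inr (Or.inr (Or.inr (Or.inr (Or.inl rfl))))))
    rw [ruleTo_holds] at h1
    have h2 := h1 (letterAssign (f (l.foldl f (epsVal p M)) b) (l'.foldl f (f x b)) x
      (l.foldl f (epsVal p M)) b x)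
    simp only [List.forall_mem_cons, List.not_mem_nil, IsEmpty.forall_iff, implies_true,
      and_true, Literal.Holds, subcA_holds, memA_holds, encA_holds] at h2
    simp only [List.foldl_append]
    exact h2 ⟨ih hl, hE _ rfl, mem_of_holds hE hK x b l'⟩

theorem equ_of_holds (hE : ∀ a : Fin 3 → M, f (a 0) (a 1) = a 2 → K (newPred p .enc) a)
    (hK : ∀ γ ∈ prog₂ p, γ.Holds K) (x y : M) (h : newSpec p f .equ ![x, y]) :
    K (newPred p .equ) ![x, y] := by
  obtain ⟨⟨l, h1, h2⟩, l', h3, h4⟩ := h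
  have h5 := subc_of_holds hE hK y l h2
  have h6 := subc_of_holds hE hK x l' h4
  rw [← show x = _ from h1] at h5
  rw [← show y = _ from h3] at h6
  have h7 := hK _ (Or.inr (Or.inr (Or.inr (Or.inr (Or.inr (Or.inr rfl))))))
  rw [ruleTo_holds] at h7
  have h8 := h7 (letterAssign x y x x x x)
  simp only [List.forall_mem_cons, List.not_mem_nil, IsEmpty.forall_iff, implies_true,
    and_true, Literal.Holds, subcA_holds, equA_holds] at h8
  exact h8 ⟨h5, h6⟩

/-- The codes of the first `j` arguments of a ground atom. -/
noncomputable def atomPrefix (p : Program L V) [(newLang p).Structure M] (f : M → M → M)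
    (a : GAtom L M) (j : ℕ) : M :=
  ((List.ofFn a.2).take j).foldl f (predFlag p M a.1)

/-- The assignment that makes the body of the rule simulating `γ` true, for derived clauses given
by `C`. -/
noncomputable def simAssign (p : Program L V) [(newLang p).Structure M] (f : M → M → M)
    (γ : Rule L V) (α : V → M) (C : ℕ → List (GAtom L M)) : DVar V → M
  | .old i => α i
  -- The simulating rule numbers `x`, `y` and the first index of `u` from 1, whereas lists are
  -- indexed from 0; hence `i - 1`. The letters `v`, `w`, `s` start at 0. The default `c_ε` is only
  -- a filler.
  | .new .x i _ => f (clauseCode p f (C (i - 1)))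
      ((posInt p γ)[i - 1]?.elim (epsVal p M) fun a => atomCode p f (a.ground α))
  | .new .y i _ => clauseCode p f (C (i - 1))
  | .new .u i j => (posInt p γ)[i - 1]?.elim (epsVal p M) fun a => atomPrefix p f (a.ground α) j
  | .new .s i j => γ.head[i]?.elim (epsVal p M) fun a => atomPrefix p f (a.ground α) j
  | .new .v i _ => clauseCode p f ((γ.head.map fun a => a.ground α).take i)
  | .new .w i _ => clauseCode p f ((γ.head.map fun a => a.ground α) ++ (List.range i).flatMap C)
  | .new .z _ _ => clauseCode p f ((γ.head.map fun a => a.ground α) ++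
      (List.range (posInt p γ).length).flatMap C)
  | .new .a _ _ => epsVal p M

/-- Induction on the derivation: a hyperresolution step is matched by the simulating rule under
`simAssign`, a change of order or multiplicity by the rule for `equ`. Extensional body atoms are
read in `K`, whence `hF`. -/
theorem tru_of_holds (hE : ∀ a : Fin 3 → M, f (a 0) (a 1) = a 2 → K (newPred p .enc) a)
    (hF : ∀ P ∉ p.intensional, K (oldPred p P) = structInterp L M P)
    (hK₂ : ∀ γ ∈ prog₂ p, γ.Holds K) (hK₃ : ∀ γ ∈ prog₃ p, γ.Holds K)
    {C : List (GAtom L M)} (hC : Derives p M C) :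
    K (newPred p .tru) ![clauseCode p f C] := by
  induction hC with
  | congr C C' hC hCC' ih =>
    have h1 := hK₃ _ (Or.inl rfl)
    rw [ruleTo_holds] at h1
    have h2 := h1 (letterAssign (clauseCode p f C) (clauseCode p f C') (epsVal p M)
      (epsVal p M) (epsVal p M) (epsVal p M))
    simp only [List.forall_mem_cons, List.not_mem_nil, IsEmpty.forall_iff, implies_true,
      and_true, Literal.Holds, truA_holds, equA_holds] at h2
    refine h2 ⟨ih, equ_of_holds hE hK₂ _ _ ⟨⟨_, rfl, ?_⟩, _, rfl, ?_⟩⟩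
    · intro v hv
      refine exists_foldl_eq_of_mem _ ?_
      obtain ⟨a, ha, rfl⟩ := List.mem_map.1 hv
      exact List.mem_map_of_mem ((hCC' a).1 ha)
    · intro v hv
      refine exists_foldl_eq_of_mem _ ?_
      obtain ⟨a, ha, rfl⟩ := List.mem_map.1 hv
      exact List.mem_map_of_mem ((hCC' a).2 ha)
  | rule γ hγ α C hC hr ih =>
    have h1 := hK₃ _ (Or.inr ⟨γ, hγ, rfl⟩)
    rw [simRule_holds] at h1
    have hβ : ∀ t : L.Term V, (liftT p t).realize (simAssign p f γ α C) = t.realize α :=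
      fun t => realize_liftT t _
    refine h1 (simAssign p f γ α C) (fun i hi => ?_) (fun i hi => ?_) (fun i hi => ?_)
      (fun i hi => ?_) ?_ ?_ rfl (fun l hl => ?_)
    · have h2 := ih i hi
      rw [clauseCode_append] at h2
      simpa [simAssign, hi] using h2
    · refine encAtom_intro hE (fun j => ?_) ?_
      · simp [simAssign, hi, hβ, atomPrefix, PAtom.ground]
      · simp [simAssign, realize_nv, hi, hβ, PAtom.ground]
    · refine encAtom_intro hE (fun j => ?_) ?_
      · simp [simAssign, hi, hβ, atomPrefix, PAtom.ground]
      · simp only [realize_nv, hβ, simAssign]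
        rw [← List.take_append_getElem (by simpa using hi), clauseCode_append]
        simp [PAtom.ground]
    · have h2 := mrg_of_holds hE hK₂ (simAssign p f γ α C (.new .w i 0))
        ((C i).map (atomCode p f))
      have h3 : simAssign p f γ α C (.new .w (i + 1) 0) =
          ((C i).map (atomCode p f)).foldl f (simAssign p f γ α C (.new .w i 0)) := by
        simp [simAssign, clauseCode, List.range_succ]
      rw [h3]
      exact h2
    · simp [simAssign, clauseCode]
    · simp only [simAssign, List.range_zero, List.flatMap_nil, List.append_nil]
      rw [List.take_of_length_le (by simp)]
    · refine (liftLit_holds K _ l ?_).2 (hr l hl)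
      rintro a rfl
      exact hF _ ((mem_restBody.1 hl).2 a rfl)

/-- The assignment for the rules about a single ground atom. -/
noncomputable def atomAssign (p : Program L V) [(newLang p).Structure M] (f : M → M → M)
    (x y : M) (a : GAtom L M) : DVar V → M
  | .new .x _ _ => x
  | .new .y _ _ => y
  | .new .u _ j => atomPrefix p f a j
  -- Indices beyond the arity do not occur in the atom, so the value `x` is arbitrary.
  | .new .a i _ => if h : i < a.1.1 then a.2 ⟨i, h⟩ else x
  | _ => x

theorem realize_argVars (x y : M) (a : GAtom L M) (j : Fin a.1.1) :
    (argVars p a.1 j).realize (atomAssign p f x y a) = a.2 j := by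
  simp [argVars, realize_nv, atomAssign]

theorem encAtom_atomAssign
    (hE : ∀ a : Fin 3 → M, f (a 0) (a 1) = a 2 → K (newPred p .enc) a) {x y : M}
    {a : GAtom L M} {t₁ t₂ : DTerm p}
    (ht : f (t₁.realize (atomAssign p f x y a)) (atomCode p f a) =
      t₂.realize (atomAssign p f x y a)) :
    ∀ b ∈ encAtom p .u 0 t₁ a.1 (argVars p a.1) t₂, b.Holds K (atomAssign p f x y a) := by
  refine encAtom_intro hE (fun j => ?_) ?_
  · simp only [realize_argVars]
    rfl
  · simp only [realize_argVars]
    exact ht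

theorem fls_of_holds (hE : ∀ a : Fin 3 → M, f (a 0) (a 1) = a 2 → K (newPred p .enc) a)
    (hK₄ : ∀ γ ∈ prog₄ p, γ.Holds K) (C : List (GAtom L M))
    (hC : ∀ b ∈ C, b.1 ∈ p.intensional ∧ ¬ (structInterp L M).Sat b) :
    K (newPred p .fls) ![clauseCode p f C] := by
  induction C using List.reverseRecOn with
  | nil =>
    have h1 := hK₄ _ (Or.inl rfl)
    rw [ruleTo_holds] at h1
    have h2 := h1 (letterAssign (epsVal p M) (epsVal p M) (epsVal p M)
      (epsVal p M) (epsVal p M) (epsVal p M))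
    simp only [List.forall_mem_singleton, Literal.Holds, flsA_holds, epsT, realize_cst] at h2
    exact h2 rfl
  | append_singleton C a ih =>
    rw [List.forall_mem_append, List.forall_mem_singleton] at hC
    have h1 := hK₄ _ (Or.inr ⟨a.1, hC.2.1, rfl⟩)
    rw [ruleTo_holds] at h1
    have h2 := h1 (atomAssign p f (clauseCode p f C) (clauseCode p f (C ++ [a])) a)
    rw [List.forall_mem_append, List.forall_mem_append, List.forall_mem_singleton,
      List.forall_mem_singleton] at h2
    simp only [Literal.Holds, flsA_holds] at h2
    refine h2 ⟨⟨ih hC.1, encAtom_atomAssign hE (clauseCode_append C a).symm⟩, fun h => ?_⟩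
    rw [genAtom_holds, structInterp_oldPred] at h
    have h3 : (fun i : Fin a.1.1 => atomAssign p f (clauseCode p f C)
        (clauseCode p f (C ++ [a])) a (.new .a i 0)) = a.2 :=
      funext fun i => realize_argVars _ _ a i
    exact hC.2.2 ((congrArg (structInterp L M a.1) h3).mp h)

theorem old_of_holds (hE : ∀ a : Fin 3 → M, f (a 0) (a 1) = a 2 → K (newPred p .enc) a)
    (hF : ∀ P ∉ p.intensional, K (oldPred p P) = structInterp L M P)
    (hK : ∀ γ ∈ diamond p, γ.Holds K) (a : GAtom L M) (ha : a.1 ∈ p.intensional)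
    (h : Supported p (structInterp L M) a) : K (oldPred p a.1) a.2 := by
  obtain ⟨-, hK₂, hK₃, hK₄, hK₅⟩ := diamond_forall.1 hK
  obtain ⟨C, hC, hCS⟩ := h
  have h1 := hK₅ _ (Or.inr ⟨a.1, ha, rfl⟩)
  rw [ruleTo_holds] at h1
  have h2 := h1 (atomAssign p f (clauseCode p f (C ++ [a])) (clauseCode p f C) a)
  rw [List.forall_mem_append, List.forall_mem_append, List.forall_mem_singleton,
    List.forall_mem_singleton] at h2
  simp only [Literal.Holds, flsA_holds, truA_holds] at h2
  have h3 := h2 ⟨⟨tru_of_holds hE hF hK₂ hK₃ hC,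
    encAtom_atomAssign hE (clauseCode_append C a).symm⟩,
    fls_of_holds hE hK₄ C fun b hb => ⟨hC.pred_mem b (by simp [hb]), hCS b hb⟩⟩
  rw [genAtom_holds] at h3
  have h4 : (fun i : Fin a.1.1 => atomAssign p f (clauseCode p f (C ++ [a]))
      (clauseCode p f C) a (.new .a i 0)) = a.2 :=
    funext fun i => realize_argVars _ _ a i
  exact (congrArg (K (oldPred p a.1)) h4).mp h3

theorem new_of_holds (hf : IsEncoding p M f)
    (hF : ∀ P ∉ p.intensional, K (oldPred p P) = structInterp L M P)
    (hK : ∀ γ ∈ diamond p, γ.Holds K) {n : ℕ} (R : NewRel.{v} n) (a : Fin n → M)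
    (h : newSpec p f R a) : K (newPred p R) a := by
  obtain ⟨hK₁, hK₂, hK₃, hK₄, -⟩ := diamond_forall.1 hK
  have hE := enc_of_holds hf hK₁
  have hv3 : ∀ a : Fin 3 → M, a = ![a 0, a 1, a 2] := fun a => by
    funext i; fin_cases i <;> rfl
  have hv2 : ∀ a : Fin 2 → M, a = ![a 0, a 1] := fun a => by funext i; fin_cases i <;> rfl
  have hv1 : ∀ a : Fin 1 → M, a = ![a 0] := fun a => by funext i; fin_cases i; rfl
  cases R with
  | enc => exact hE a h
  | nenc => exact nenc_of_holds hf hK₁ a h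
  | ok => exact ok_of_holds hf hK₁ a
  | mrg =>
    obtain ⟨l, h1, h2⟩ := h
    rw [hv3 a, h1, h2]
    exact mrg_of_holds hE hK₂ (a 0) l
  | mem =>
    obtain ⟨x, l, h1⟩ := h
    rw [hv2 a, h1]
    exact mem_of_holds hE hK₂ x (a 0) l
  | subc =>
    obtain ⟨l, h1, h2⟩ := h
    rw [hv2 a, h1]
    exact subc_of_holds hE hK₂ (a 1) l h2
  | equ =>
    rw [hv2 a] at h ⊢
    exact equ_of_holds hE hK₂ (a 0) (a 1) h
  | tru =>
    obtain ⟨C, hC, h1⟩ := h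
    rw [hv1 a, h1]
    exact tru_of_holds hE hF hK₂ hK₃ hC
  | fls =>
    obtain ⟨C, h1, hC⟩ := h
    rw [hv1 a, h1]
    exact fls_of_holds hE hK₄ C hC

end Least

/-! ### Forcing the encoding, and the two directions of the equivalence -/

section Main

variable {L : FirstOrder.Language.{u, v}} {V : Type w} {p : Program L V} {M : Type x}
  [L.Structure M]

/-- A stable model is contained in every smaller interpretation that satisfies the rules. -/
theorem Program.SM.le_of_holds (h : p.SM M) {K : Interp L M} (hF : p.Fixes K)
    (hK : ∀ γ ∈ p, γ.Holds K) (hle : ∀ P a, K P a → structInterp L M P a) (P : Pred L)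
    (a : Fin P.1 → M) (ha : structInterp L M P a) : K P a := by
  by_cases hP : P ∈ p.intensional
  · by_contra hn
    refine h.2 K ⟨fun P _ => hle P, fun hall => hn (hall P hP a ha)⟩ ?_
    rwa [hF.star_eq]
  · rwa [hF P hP]

section Expansion

variable [(newLang p).Structure M]

variable (p M) in
/-- The structure with `enc` replaced by the complement of its companion, and conversely, and with
`ok` replaced by the domain of the new value of `enc`. -/
def swapEnc : Interp (bigLang p) M :=
  joinInterp p (fun P => structInterp (bigLang p) M (oldPred p P)) fun {n} R =>
    match n, R with
    | 3, .enc => fun a => ¬ structInterp (bigLang p) M (newPred p .nenc) a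
    | 3, .nenc => fun a => ¬ structInterp (bigLang p) M (newPred p .enc) a
    | 2, .ok => fun a => ∃ z : M, ¬ structInterp (bigLang p) M (newPred p .nenc) ![a 0, a 1, z]
    | _, .mrg => structInterp (bigLang p) M (newPred p .mrg)
    | _, .mem => structInterp (bigLang p) M (newPred p .mem)
    | _, .subc => structInterp (bigLang p) M (newPred p .subc)
    | _, .equ => structInterp (bigLang p) M (newPred p .equ)
    | _, .tru => structInterp (bigLang p) M (newPred p .tru)
    | _, .fls => structInterp (bigLang p) M (newPred p .fls)

theorem enc_or_nenc (h : ∀ γ ∈ diamond p, γ.Holds (structInterp (bigLang p) M))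
    (a : Fin 3 → M) : structInterp (bigLang p) M (newPred p .enc) a ∨
      structInterp (bigLang p) M (newPred p .nenc) a := by
  obtain ⟨h₁, -⟩ := diamond_forall.1 h
  have h1 := h₁ _ (Or.inr (Or.inl rfl))
  rw [ruleTo_holds] at h1
  have h2 := h1 (letterAssign (a 0) (a 1) (a 2) (a 0) (a 0) (a 0))
  simp only [List.forall_mem_singleton, Literal.Holds, nencA_holds, encA_holds] at h2
  rw [show a = ![a 0, a 1, a 2] from by funext i; fin_cases i <;> rfl]
  exact or_iff_not_imp_right.2 h2

/-- The rule `¬ok → ok` acts as a constraint: it makes `ok` hold everywhere in a model, but in the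
reduct it then has a false body and lends `ok` no support. -/
theorem ok_of_model (h : ∀ γ ∈ diamond p, γ.Holds (structInterp (bigLang p) M))
    (a : Fin 2 → M) : structInterp (bigLang p) M (newPred p .ok) a := by
  obtain ⟨h₁, -⟩ := diamond_forall.1 h
  have h1 := h₁ _ (Or.inr (Or.inr (Or.inr (Or.inr (Or.inr (Or.inr (Or.inl rfl)))))))
  rw [ruleTo_holds] at h1
  have h2 := h1 (letterAssign (a 0) (a 1) (a 0) (a 0) (a 0) (a 0))
  simp only [List.forall_mem_singleton, Literal.Holds, okA_holds] at h2
  rw [show a = ![a 0, a 1] from by funext i; fin_cases i <;> rfl]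
  exact by_contra fun hn => hn (h2 hn)

theorem swapEnc_le (h : ∀ γ ∈ diamond p, γ.Holds (structInterp (bigLang p) M))
    (P : Pred (bigLang p)) (a : Fin P.1 → M) (ha : swapEnc p M P a) :
    structInterp (bigLang p) M P a := by
  rcases pred_cases P with ⟨Q, rfl⟩ | ⟨n, R, rfl⟩
  · exact ha
  · cases R with
    | enc => exact (enc_or_nenc h a).resolve_right ha
    | nenc => exact (enc_or_nenc h a).resolve_left ha
    | ok => exact ok_of_model h a
    | mrg | mem | subc | equ | tru | fls => exact ha

/-- The two choice rules and the rule from `enc` to `ok` hold by the definition of the swapped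
values, and `¬ok → ok` is vacuous because `ok` is total in the structure. All other rules have
unchanged heads, or none, and their bodies only become stronger. -/
theorem swapEnc_holds (h : ∀ γ ∈ diamond p, γ.Holds (structInterp (bigLang p) M)) :
    ∀ γ ∈ diamond p, γ.Holds (swapEnc p M) := by
  have hm : ∀ γ ∈ diamond p,
      (∀ a ∈ γ.head, swapEnc p M a.pred = structInterp (bigLang p) M a.pred) →
        γ.Holds (swapEnc p M) := fun γ hγ hh => (h γ hγ).mono (swapEnc_le h) hh
  have hb : ∀ (b : DLit p) (body : List (DLit p)), ruleBot p b body ∈ diamond p →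
      (ruleBot p b body).Holds (swapEnc p M) := fun b body hγ => hm _ hγ (by simp [ruleBot])
  have ht : ∀ (body : List (DLit p)) (a : PAtom (bigLang p) (DVar V)),
      ruleTo p body a ∈ diamond p → swapEnc p M a.pred = structInterp (bigLang p) M a.pred →
        (ruleTo p body a).Holds (swapEnc p M) :=
    fun body a hγ ha => hm _ hγ (by simpa [ruleTo] using ha)
  have hd := diamond_forall.1 fun (γ : Rule (bigLang p) (DVar V)) (hγ : γ ∈ diamond p) => hγ
  refine diamond_forall.2 ⟨?_, ?_, ?_, ?_, ?_⟩
  · rintro γ hγ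
    have hγ' := hd.1 γ hγ
    rcases hγ with (⟨c, rfl⟩ | ⟨c, d, -, rfl⟩) | hγ
    · exact hb _ _ hγ'
    · exact hb _ _ hγ'
    · simp only [Set.mem_insert_iff, Set.mem_singleton_iff] at hγ
      rcases hγ with rfl | rfl | rfl | rfl | rfl | rfl | rfl
      · rw [ruleTo_holds]
        intro α h1
        rw [List.forall_mem_singleton, Literal.Holds, nencA_holds] at h1
        rw [encA_holds]
        exact h1
      · rw [ruleTo_holds]
        intro α h1
        rw [List.forall_mem_singleton, Literal.Holds, encA_holds] at h1
        rw [nencA_holds]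
        exact h1
      · exact hb _ _ hγ'
      · exact hb _ _ hγ'
      · rw [ruleTo_holds]
        intro α h1
        rw [List.forall_mem_singleton, Literal.Holds, encA_holds] at h1
        rw [okA_holds]
        exact ⟨_, h1⟩
      · rw [ruleTo_holds]
        intro α h1
        rw [List.forall_mem_singleton, Literal.Holds, okA_holds] at h1
        exact absurd (ok_of_model h _) h1
      · exact hb _ _ hγ'
  · intro γ hγ
    have hγ' := hd.2.1 γ hγ
    simp only [prog₂, Set.mem_insert_iff, Set.mem_singleton_iff] at hγ
    rcases hγ with rfl | rfl | rfl | rfl | rfl | rfl | rfl <;> exact ht _ _ hγ' rfl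
  · intro γ hγ
    have hγ' := hd.2.2.1 γ hγ
    rcases hγ with rfl | ⟨δ, -, rfl⟩ <;> exact ht _ _ hγ' rfl
  · intro γ hγ
    have hγ' := hd.2.2.2.1 γ hγ
    rcases hγ with rfl | ⟨P, -, rfl⟩ <;> exact ht _ _ hγ' rfl
  · intro γ hγ
    have hγ' := hd.2.2.2.2 γ hγ
    rcases hγ with rfl | ⟨P, -, rfl⟩
    · exact hb _ _ hγ'
    · exact ht _ _ hγ' rfl

theorem fixes_diamond {K : Interp (bigLang p) M}
    (hK : ∀ P ∉ p.intensional, K (oldPred p P) = structInterp L M P) : (diamond p).Fixes K := by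
  intro P hP
  rcases pred_cases P with ⟨Q, rfl⟩ | ⟨n, R, rfl⟩
  · rw [oldPred_mem_intensional] at hP
    rw [hK Q hP, structInterp_oldPred]
  · exact absurd (newPred_mem_intensional R) hP

theorem fixed_old {K : Interp (bigLang p) M} (hK : (diamond p).Fixes K) :
    ∀ P ∉ p.intensional, K (oldPred p P) = structInterp L M P := fun P hP => by
  rw [hK _ (fun h => hP (oldPred_mem_intensional.1 h)), structInterp_oldPred]

/-- In a stable model of the translated program, `enc` is an encoding of pairs. -/
theorem exists_isEncoding (h : (diamond p).SM M) : ∃ f : M → M → M, IsEncoding p M f := by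
  -- By stability the swapped interpretation is not strictly smaller, so the structure is contained
  -- in it. For `enc` this gives disjointness from its companion, for `ok` it gives totality of
  -- `enc`.
  have hle := h.le_of_holds (K := swapEnc p M)
    (fixes_diamond fun P _ => structInterp_oldPred P) (swapEnc_holds h.1) (swapEnc_le h.1)
  have hne : ∀ a : Fin 3 → M, structInterp (bigLang p) M (newPred p .enc) a ↔
      ¬ structInterp (bigLang p) M (newPred p .nenc) a := fun a =>
    ⟨hle (newPred p .enc) a, (enc_or_nenc h.1 a).resolve_right⟩
  have htot : ∀ x y : M, ∃ z : M, structInterp (bigLang p) M (newPred p .enc) ![x, y, z] := by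
    intro x y
    obtain ⟨z, hz⟩ := hle (newPred p .ok) ![x, y] (ok_of_model h.1 _)
    exact ⟨z, (hne _).2 hz⟩
  choose f hf using htot
  obtain ⟨h₁, -⟩ := diamond_forall.1 h.1
  have hfun : ∀ x y z u : M, structInterp (bigLang p) M (newPred p .enc) ![x, y, z] →
      structInterp (bigLang p) M (newPred p .enc) ![x, y, u] → z = u := by
    intro x y z u h1 h2
    have h3 := h₁ _ (Or.inr (Or.inr (Or.inr (Or.inr (Or.inr (Or.inr (Or.inr rfl)))))))
    rw [ruleBot_holds] at h3
    have h4 := h3 (letterAssign x y z u x x)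
    simp only [List.forall_mem_cons, List.not_mem_nil, IsEmpty.forall_iff, implies_true,
      and_true, Literal.Holds, encA_holds] at h4
    exact by_contra fun hn => h4 h1 ⟨h2, hn⟩
  have hinj : ∀ x y z u v : M, structInterp (bigLang p) M (newPred p .enc) ![x, y, z] →
      structInterp (bigLang p) M (newPred p .enc) ![u, v, z] → x = u ∧ y = v := by
    intro x y z u v h1 h2
    have h3 := h₁ _ (Or.inr (Or.inr (Or.inr (Or.inl rfl))))
    have h5 := h₁ _ (Or.inr (Or.inr (Or.inr (Or.inr (Or.inl rfl)))))
    rw [ruleBot_holds] at h3 h5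
    have h4 := h3 (letterAssign x y z u v x)
    have h6 := h5 (letterAssign x y z u v x)
    simp only [List.forall_mem_cons, List.not_mem_nil, IsEmpty.forall_iff, implies_true,
      and_true, Literal.Holds, encA_holds] at h4 h6
    exact ⟨by_contra fun hn => h4 h1 ⟨h2, hn⟩, by_contra fun hn => h6 h1 ⟨h2, hn⟩⟩
  have henc : ∀ a : Fin 3 → M, structInterp (bigLang p) M (newPred p .enc) a ↔
      f (a 0) (a 1) = a 2 := by
    intro a
    rw [show a = ![a 0, a 1, a 2] from by funext i; fin_cases i <;> rfl]
    refine ⟨fun h1 => hfun _ _ _ _ (hf _ _) h1, fun h1 => ?_⟩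
    have h2 := hf (a 0) (a 1)
    rwa [show f (a 0) (a 1) = a 2 from h1] at h2
  refine ⟨f, henc, fun a => ?_, ok_of_model h.1, fun x y x' y' hxy => ?_, fun c x y hc => ?_,
    fun c d hcd => ?_⟩
  · rw [← henc, hne, not_not]
  · have h1 := hf x y
    rw [hxy] at h1
    exact hinj _ _ _ _ _ h1 (hf x' y')
  · have h1 := h₁ _ (Or.inl (Or.inl ⟨c, rfl⟩))
    rw [ruleBot_holds] at h1
    have h2 := h1 (letterAssign x y x x x x)
    simp only [Literal.Holds, encA_holds, realize_cst] at h2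
    refine h2 ?_ (by simp)
    have h3 := hf x y
    rwa [hc] at h3
  · by_contra hn
    have h1 := h₁ _ (Or.inl (Or.inr ⟨c, d, hn, rfl⟩))
    rw [ruleBot_holds] at h1
    have h2 := h1 (fun _ => flagVal M c)
    simp only [Literal.Holds, realize_cst] at h2
    exact h2 hcd (by simp)

/-- Minimality, applied to the intended interpretation, makes every true intensional atom supported;
the rules themselves make supported atoms true. -/
theorem SM_of_SM_diamond (h : (diamond p).SM M) : p.SM M := by
  obtain ⟨f, hf⟩ := exists_isEncoding h
  have hF : ∀ P ∉ p.intensional, structInterp (bigLang p) M (oldPred p P) =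
      structInterp L M P := fun P _ => structInterp_oldPred P
  obtain ⟨h₁, h₂, h₃, -, h₅⟩ := diamond_forall.1 h.1
  have hE : ¬ Derives p M ([] : List (GAtom L M)) := by
    intro hD
    have h1 := h₅ _ (Or.inl rfl)
    rw [ruleBot_holds] at h1
    refine h1 (fun _ => epsVal p M) ?_ (by simp)
    simp only [Literal.Holds, truA_holds, epsT, realize_cst]
    exact tru_of_holds (enc_of_holds hf h₁) hF h₂ h₃ hD
  have hold : ∀ a : GAtom L M, a.1 ∈ p.intensional → Supported p (structInterp L M) a →
      (structInterp L M).Sat a := by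
    intro a ha hs
    have h1 := old_of_holds (enc_of_holds hf h₁) hF h.1 a ha hs
    rwa [structInterp_oldPred] at h1
  let K : Interp (bigLang p) M := (diamond p).star (spec p f)
  have hKf : (diamond p).Fixes K := (diamond p).fixes_star _
  have hK : IsSpec f K :=
    { new := fun R => Program.star_of_mem (newPred_mem_intensional R) _
      old := fun P hP a => Iff.of_eq
        (congrFun (Program.star_of_mem (oldPred_mem_intensional.2 hP) (spec p f)) a)
      fixed := fixed_old hKf }
  have hle : ∀ P a, K P a → structInterp (bigLang p) M P a := by
    intro P a ha
    rcases pred_cases P with ⟨Q, rfl⟩ | ⟨n, R, rfl⟩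
    · by_cases hQ : Q ∈ p.intensional
      · rw [structInterp_oldPred]
        exact hold ⟨Q, a⟩ hQ ((hK.old Q hQ a).1 ha)
      · rw [structInterp_oldPred, ← hK.fixed Q hQ]
        exact ha
    · rw [hK.new R] at ha
      exact new_of_holds hf hF h.1 R a ha
  rw [p.SM_iff_supported]
  refine ⟨fun C hC => ?_, fun a ha hs => ?_⟩
  · by_contra hn
    push Not at hn
    -- A nonempty derived clause with all atoms false would support its last atom and thereby make
    -- it true.
    rcases List.eq_nil_or_concat C with rfl | ⟨C', a, rfl⟩
    · exact hE hC
    · rw [List.concat_eq_append] at hC hn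
      exact hn a (by simp) (hold a (hC.pred_mem a (by simp))
        ⟨C', hC, fun b hb => hn b (by simp [hb])⟩)
  · refine (hK.old a.1 ha a.2).1 (h.le_of_holds hKf (hK.diamond_holds hf hE) hle _ _ ?_)
    rw [structInterp_oldPred]
    exact hs

/-- In a stable model of `p` true and supported intensional atoms coincide, so the expansion is the
intended interpretation, which lies below every interpretation satisfying the rules. -/
theorem SM_diamond_of_isSpec {f : M → M → M} (h : p.SM M) (hf : IsEncoding p M f)
    (hN : ∀ {n : ℕ} (R : NewRel.{v} n),
      structInterp (bigLang p) M (newPred p R) = newSpec p f R) : (diamond p).SM M := by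
  obtain ⟨hD, hS⟩ := p.SM_iff_supported.1 h
  have hE : ¬ Derives p M ([] : List (GAtom L M)) := fun h => by simpa using hD _ h
  have hK : IsSpec f (structInterp (bigLang p) M) :=
    { new := hN
      old := fun P hP a => by
        rw [structInterp_oldPred]
        refine ⟨hS ⟨P, a⟩ hP, ?_⟩
        rintro ⟨C, hC, hCS⟩
        obtain ⟨b, hb, hbS⟩ := hD _ hC
        rw [List.mem_append, List.mem_singleton] at hb
        rcases hb with hb | rfl
        · exact absurd hbS (hCS b hb)
        · exact hbS
      fixed := fun P _ => structInterp_oldPred P }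
  refine ⟨hK.diamond_holds hf hE, fun I hI hm => hI.2 fun P hP a ha => ?_⟩
  have hF := fixed_old ((diamond p).fixes_star I)
  rw [← Program.star_of_mem hP I]
  rcases pred_cases P with ⟨Q, rfl⟩ | ⟨n, R, rfl⟩
  · have hQ := oldPred_mem_intensional.1 hP
    exact old_of_holds (enc_of_holds hf (diamond_forall.1 hm).1) hF hm ⟨Q, a⟩ hQ
      ((hK.old Q hQ a).1 ha)
  · rw [hN R] at ha
    exact new_of_holds hf hF hm R a ha

end Expansion

/-- For infinite `M` the disjoint union of `M × M` and a finite set has cardinality at most that of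
`M`. One injection of this sum provides the pairing and the flags, with disjoint ranges. -/
theorem exists_pairing (A : Type*) [Finite A] (M : Type x) [Infinite M] :
    ∃ (g : A → M) (f : M → M → M), Function.Injective g ∧ PairInjective f ∧
      ∀ c x y, f x y ≠ g c := by
  obtain ⟨n, ⟨e⟩⟩ := Finite.exists_equiv_fin A
  have hM := Cardinal.aleph0_le_mk M
  have hc : Cardinal.mk ((M × M) ⊕ ULift.{x} (Fin n)) ≤ Cardinal.mk M := by
    have h1 : Cardinal.mk (M × M) = Cardinal.mk M := by
      rw [Cardinal.mk_prod, Cardinal.lift_id, Cardinal.mul_eq_self hM]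
    have h2 : Cardinal.mk (ULift.{x} (Fin n)) ≤ Cardinal.mk M :=
      (Cardinal.lt_aleph0_of_finite _).le.trans hM
    rw [Cardinal.mk_sum, Cardinal.lift_id, Cardinal.lift_id, h1, Cardinal.add_eq_left hM h2]
  obtain ⟨i⟩ := hc
  refine ⟨fun c => i (Sum.inr ⟨e c⟩), fun x y => i (Sum.inl (x, y)), fun c d h => ?_,
    fun x y x' y' h => ?_, fun c x y h => ?_⟩
  · have h1 := Sum.inr.inj (i.injective h)
    exact e.injective (ULift.up.inj h1)
  · have h1 := Sum.inl.inj (i.injective h)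
    exact Prod.mk.inj h1
  · cases i.injective h

variable (p) in
/-- The interpretation of the new constants with the given flags, the predicates being empty. -/
abbrev flagStructure (g : NewFun p 0 → M) : (newLang p).Structure M where
  funMap {n} c _ := g (match n, c with
    | _, .eps => .eps
    | _, .flag P h => .flag P h)
  RelMap _ _ := False

variable (p) in
/-- The interpretation of the new constants that encodes pairs by `f`, with the given flags. -/
abbrev specStructure (g : NewFun p 0 → M) (f : M → M → M) : (newLang p).Structure M where
  funMap {n} c a := (flagStructure p g).funMap (n := n) c a
  -- `newSpec` depends on the structure of new constants only through the flags, so the empty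
  -- relations of `flagStructure` are placeholders and the definition is not circular.
  RelMap {n} R a := letI := flagStructure p g; newSpec p f (n := n) R a

theorem exists_SM_diamond [Infinite M] (hp : p.Finite) (h : p.SM M) :
    ∃ _ : (newLang p).Structure M, (diamond p).SM M := by
  have := finite_newFun hp
  obtain ⟨g, f, hg, hf, hgf⟩ := exists_pairing (NewFun p 0) M
  let := specStructure p g f
  refine ⟨specStructure p g f, ?_⟩
  have hfl : ∀ c : NewFun p 0, flagVal M c = g c := by
    intro c
    cases c <;> rfl
  have hN : ∀ {n : ℕ} (R : NewRel.{v} n),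
      structInterp (bigLang p) M (newPred p R) = newSpec p f R := by
    intro n R
    cases R <;> rfl
  refine SM_diamond_of_isSpec h (f := f) ⟨fun a => ?_, fun a => ?_, fun a => ?_, hf,
    fun c x y => ?_, fun c d hcd => ?_⟩ hN
  · rw [hN]; rfl
  · rw [hN]; rfl
  · rw [hN]; exact trivial
  · rw [hfl]; exact hgf c x y
  · rw [hfl, hfl] at hcd
    exact hg hcd

end Main

end DLP

theorem mainTheorem1 {L : FirstOrder.Language.{u, v}} {V : Type w} (p : DLP.Program L V)
    (hp : p.Finite) :
    (DLP.diamond p).Finite ∧ DLP.Program.IsNormal (DLP.diamond p) ∧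
      ∀ (M : Type x) [Infinite M] [L.Structure M],
        DLP.Program.SM p M ↔
          ∃ _ : (DLP.newLang p).Structure M, DLP.Program.SM (DLP.diamond p) M :=
  ⟨DLP.diamond_finite hp, DLP.diamond_isNormal, fun _ _ _ =>
    ⟨DLP.exists_SM_diamond hp, fun ⟨_, h⟩ => DLP.SM_of_SM_diamond h⟩⟩
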